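/- Let $k\ge 2$ and let $\sigma:[0,\infty)\to[0,\infty)$ be a smooth function with $\sigma(r)>0$ for $r>0$, $\sigma(0)=0$, $\sigma'(0)=1$ and $\sigma'(1)=0$, such that $ds^2=dr^2+\sigma^2(r)\,d\theta^2$ is a smooth Riemannian metric on $\mathbb R^k$ (where $r=|x|$, $d\theta^2$ is the standard metric of the unit sphere $S^{k-1}$, and $ds^2$ is the Euclidean inner product at the origin). Put $B=(\mathbb R^k,ds^2)$ and let $\mathcal S=S^{k-1}\subset B$ be the unit sphere, which is totally geodesic in $B$. Let $(N',\langle\,,\rangle_{N'})$ be any Riemannian manifold (without boundary), let $\rho:B\to(0,\infty)$ be smooth, and assume that the $ds^2$-gradient $\nabla\rho$ is tangent to $\mathcal S$ at every point of $\mathcal S$. Let $M=B\times_\rho N'$ be the warped product, that is, $B\times N'$ with the metric $\pi_B^*ds^2+(\rho\circ\pi_B)^2\,\pi_{N'}^*\langle\,,\rangle_{N'}$. Then: (1) the inclusion $f:\mathcal S\times N'\to M$ is a totally geodesic immersion (its second fundamental form vanishes); (2) for the inclusion $g:\{0\}\times N'\to M$ with normal bundle $\mathcal N_g$, the normal exponential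 map $\exp^\perp:\mathcal N_g\to M$, $(p,\nu)\mapsto\exp_{g(p)}\nu$, is defined on all of $\mathcal N_g$ and is a diffeomorphism onto $M$; (3) $g$ is free of focal points, that is, the differential of $\exp^\perp:\mathcal N_g\to M$ is injective at every point of $\mathcal N_g$. -/

import Mathlib

open Set Bundle
open scoped Manifold ContDiff Topology

noncomputable section

/-! ### Pulling back bilinear forms on tangent spaces -/

section Pullback

variable {E : Type*} [NormedAddCommGroup E] [NormedSpace ℝ E]
  {H : Type*} [TopologicalSpace H] {I : ModelWithCorners ℝ E H}
  {M : Type*} [TopologicalSpace M] [ChartedSpace H M]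
  {E' : Type*} [NormedAddCommGroup E'] [NormedSpace ℝ E']
  {H' : Type*} [TopologicalSpace H'] {I' : ModelWithCorners ℝ E' H'}
  {M' : Type*} [TopologicalSpace M'] [ChartedSpace H' M']

set_option synthInstance.maxHeartbeats 200000 in
theorem contMDiffAt_flip {F₁ F₂ : Type*} [NormedAddCommGroup F₁] [NormedSpace ℝ F₁]
    [NormedAddCommGroup F₂] [NormedSpace ℝ F₂] {φ : M → F₁ →L[ℝ] F₂ →L[ℝ] ℝ} {x₀ : M}
    (hφ : ContMDiffAt I 𝓘(ℝ, F₁ →L[ℝ] F₂ →L[ℝ] ℝ) ∞ φ x₀) :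
    ContMDiffAt I 𝓘(ℝ, F₂ →L[ℝ] F₁ →L[ℝ] ℝ) ∞ (fun x => (φ x).flip) x₀ := by
  let L : (F₁ →L[ℝ] F₂ →L[ℝ] ℝ) →L[ℝ] (F₂ →L[ℝ] F₁ →L[ℝ] ℝ) :=
    (ContinuousLinearMap.flipₗᵢ ℝ F₁ F₂ ℝ).toContinuousLinearEquiv
  have hL : ContDiff ℝ ∞ (fun B : F₁ →L[ℝ] F₂ →L[ℝ] ℝ => B.flip) :=
    ContinuousLinearMap.contDiff (𝕜 := ℝ) (E := F₁ →L[ℝ] F₂ →L[ℝ] ℝ)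
      (F := F₂ →L[ℝ] F₁ →L[ℝ] ℝ) L
  exact (hL.contMDiff).contMDiffAt.comp x₀ hφ

variable (I I') in
/-- The pullback `f^* b`, that is `(f^* b)_x (u, v) = b_{f x} (df_x u, df_x v)`. -/
def pullbackForm (f : M → M')
    (b : ∀ y : M', TangentSpace I' y →L[ℝ] TangentSpace I' y →L[ℝ] ℝ) (x : M) :
    TangentSpace I x →L[ℝ] TangentSpace I x →L[ℝ] ℝ :=
  ContinuousLinearMap.bilinearComp (E := E') (F := E') (E' := E) (F' := E)
    (b (f x)) (mfderiv I I' f x) (mfderiv I I' f x)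

theorem pullbackForm_apply (f : M → M')
    (b : ∀ y : M', TangentSpace I' y →L[ℝ] TangentSpace I' y →L[ℝ] ℝ) (x : M)
    (u v : TangentSpace I x) :
    pullbackForm I I' f b x u v = b (f x) (mfderiv I I' f x u) (mfderiv I I' f x v) := rfl

theorem contMDiff_pullbackForm [IsManifold I ∞ M] [IsManifold I' ∞ M'] {f : M → M'}
    (hf : ContMDiff I I' ∞ f)
    {b : ∀ y : M', TangentSpace I' y →L[ℝ] TangentSpace I' y →L[ℝ] ℝ}
    (hb : ContMDiff I' (I'.prod 𝓘(ℝ, E' →L[ℝ] E' →L[ℝ] ℝ)) ∞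
      (fun y => TotalSpace.mk' (E' →L[ℝ] E' →L[ℝ] ℝ) y (b y))) :
    ContMDiff I (I.prod 𝓘(ℝ, E →L[ℝ] E →L[ℝ] ℝ)) ∞
      (fun x => TotalSpace.mk' (E →L[ℝ] E →L[ℝ] ℝ) x (pullbackForm I I' f b x)) := by
  intro x₀
  have h1 := (contMDiffAt_hom_bundle _).1 (hb (f x₀))
  rw [contMDiffAt_hom_bundle]
  refine ⟨contMDiffAt_id, ?_⟩
  have h2 := (h1.2.comp x₀ (hf x₀))
  have h3 := ContMDiffAt.mfderiv_const (m := ∞) (hf x₀) (by simp)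
  have h4 := contMDiffAt_flip ((contMDiffAt_flip (h2.clm_comp h3)).clm_comp h3)
  refine ContMDiffAt.congr_of_eventuallyEq h4 ?_
  have hx₀ : ∀ᶠ x in 𝓝 x₀, x ∈ (chartAt H x₀).source :=
    (chartAt H x₀).open_source.mem_nhds (mem_chart_source H x₀)
  have hfx₀ : ∀ᶠ x in 𝓝 x₀, f x ∈ (chartAt H' (f x₀)).source :=
    hf.continuous.continuousAt.eventually
      ((chartAt H' (f x₀)).open_source.mem_nhds (mem_chart_source H' (f x₀)))
  filter_upwards [hx₀, hfx₀] with x hx hfx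
  ext u v
  have hx' : x ∈ (trivializationAt E (TangentSpace I) x₀).baseSet := hx
  have hfx' : f x ∈ (trivializationAt E' (TangentSpace I') (f x₀)).baseSet := hfx
  have hA : ∀ w : E, (trivializationAt E' (TangentSpace I') (f x₀)).symm (f x)
      (inTangentCoordinates I I' id f (fun x => mfderiv I I' f x) x₀ x w)
      = mfderiv I I' f x ((trivializationAt E (TangentSpace I) x₀).symm x w) := by
    intro w
    have h := ContinuousLinearMap.inCoordinates_eq (ϕ := mfderiv I I' f x) hx' hfx'
    change (trivializationAt E' (TangentSpace I') (f x₀)).symm (f x)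
      (ContinuousLinearMap.inCoordinates E (TangentSpace I) E' (TangentSpace I') x₀ x (f x₀) (f x)
        (mfderiv I I' f x) w) = _
    rw [h]
    simp only [ContinuousLinearMap.coe_comp, ContinuousLinearEquiv.coe_coe, Function.comp_apply]
    exact ((trivializationAt E' (TangentSpace I') (f x₀)).continuousLinearEquivAt ℝ (f x)
      hfx').symm_apply_apply _
  rw [inCoordinates_apply_eq₂ hx' hx' (Set.mem_univ _)]
  simp only [Function.comp_apply, ContinuousLinearMap.flip_apply, ContinuousLinearMap.coe_comp]
  rw [inCoordinates_apply_eq₂ hfx' hfx' (Set.mem_univ _), hA, hA]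
  rfl

end Pullback

/-- In finite dimension the unit ball of a positive definite form is bounded. -/
theorem isVonNBounded_of_posDef {E : Type*} [NormedAddCommGroup E] [NormedSpace ℝ E]
    [FiniteDimensional ℝ E] (b : E →L[ℝ] E →L[ℝ] ℝ) (hb : ∀ v, v ≠ 0 → 0 < b v v) :
    Bornology.IsVonNBounded ℝ {v : E | b v v < 1} := by
  rw [NormedSpace.isVonNBounded_iff]
  rcases subsingleton_or_nontrivial E with hE | hE
  · exact (Set.toFinite _).isBounded
  have hcont : Continuous fun v : E => b v v := by fun_prop
  have hne : (Metric.sphere (0 : E) 1).Nonempty := NormedSpace.sphere_nonempty.2 zero_le_one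
  obtain ⟨u, hu, hmin⟩ := (isCompact_sphere (0 : E) 1).exists_isMinOn hne hcont.continuousOn
  have hu0 : u ≠ 0 := by
    rintro rfl
    simp at hu
  have hm := hb u hu0
  have key : ∀ v : E, b u u * ‖v‖ ^ 2 ≤ b v v := by
    intro v
    rcases eq_or_ne v 0 with rfl | hv
    · simp
    have hn : ‖v‖ ≠ 0 := norm_ne_zero_iff.2 hv
    have h1 : ‖v‖⁻¹ • v ∈ Metric.sphere (0 : E) 1 := by
      simp [norm_smul, hn]
    have h2 : b u u ≤ b (‖v‖⁻¹ • v) (‖v‖⁻¹ • v) := hmin h1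
    have h3 : b (‖v‖⁻¹ • v) (‖v‖⁻¹ • v) * ‖v‖ ^ 2 = b v v := by
      simp only [map_smul, smul_apply, smul_eq_mul]
      field_simp
    rw [← h3]
    gcongr
  refine (Metric.isBounded_iff_subset_closedBall 0).2 ⟨1 + (b u u)⁻¹, fun v hv => ?_⟩
  have hv' : b v v < 1 := hv
  rw [mem_closedBall_zero_iff]
  have h4 : ‖v‖ ^ 2 ≤ (b u u)⁻¹ := by
    rw [← one_div, le_div_iff₀ hm]
    nlinarith [key v]
  nlinarith [norm_nonneg v, sq_nonneg (‖v‖ - 1), inv_pos.2 hm]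

/-- A smooth Riemannian metric on a manifold. -/
abbrev RiemMetric {E : Type*} [NormedAddCommGroup E] [NormedSpace ℝ E]
    {H : Type*} [TopologicalSpace H] (I : ModelWithCorners ℝ E H)
    (M : Type*) [TopologicalSpace M] [ChartedSpace H M] [IsManifold I ∞ M] :=
  ContMDiffRiemannianMetric I ∞ E (fun x : M => TangentSpace I x)

/-! ### Geodesics, the exponential map, submanifolds

`M` is a manifold without boundary with a Riemannian metric `g`; all formulas are the classical
ones in the charts of `M`. -/

section Geometry

variable {E : Type*} [NormedAddCommGroup E] [NormedSpace ℝ E]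
  {H : Type*} [TopologicalSpace H] {I : ModelWithCorners ℝ E H}
  {M : Type*} [TopologicalSpace M] [ChartedSpace H M] [IsManifold I ∞ M]
  {F : Type*} [NormedAddCommGroup F] [NormedSpace ℝ F]
  {G : Type*} [TopologicalSpace G] {J : ModelWithCorners ℝ F G}
  {N : Type*} [TopologicalSpace N] [ChartedSpace G N] [IsManifold J ∞ N]

/-- The matrix `g_{ij}` of the metric in the chart at `x₀`, as a function of the coordinates `y`:
the pullback of `g` under the inverse of the chart. -/
def metricInChart (g : RiemMetric I M) (x₀ : M) (y : E) : E →L[ℝ] E →L[ℝ] ℝ :=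
  pullbackForm 𝓘(ℝ, E) I (extChartAt I x₀).symm g.inner y

/-- The Christoffel symbols of the first kind in the chart at `x₀`, at the coordinates `y`:
`christoffel g x₀ y u v w = (1/2) (∂_u g(v,w) + ∂_v g(u,w) - ∂_w g(u,v)) = g(Γ(u,v), w)`
where `Γ` are the Christoffel symbols of the Levi-Civita connection. -/
def christoffel (g : RiemMetric I M) (x₀ : M) (y u v w : E) : ℝ :=
  (1 / 2) * (fderiv ℝ (metricInChart g x₀) y u v w + fderiv ℝ (metricInChart g x₀) y v u w
    - fderiv ℝ (metricInChart g x₀) y w u v)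

/-- `γ` is a geodesic on the open set `T` of times: it is smooth there and in every chart
`g(c'' + Γ(c', c'), w) = 0` for all vectors `w`, where `c` is `γ` read in the chart. -/
def IsGeodesicOn (g : RiemMetric I M) (γ : ℝ → M) (T : Set ℝ) : Prop :=
  ContMDiffOn 𝓘(ℝ, ℝ) I ∞ γ T ∧
  ∀ x₀ : M, ∀ t ∈ T, γ t ∈ (chartAt H x₀).source → ∀ w : E,
    let c : ℝ → E := fun s => extChartAt I x₀ (γ s)
    metricInChart g x₀ (c t) (deriv (deriv c) t) w
      + christoffel g x₀ (c t) (deriv c t) (deriv c t) w = 0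

/-- `IsExp g v q`: the geodesic with initial velocity `v` is defined on `[0,1]` (that is, on an
open interval containing it) and its value at time `1` is `q`. -/
def IsExp (g : RiemMetric I M) (v : TangentBundle I M) (q : M) : Prop :=
  ∃ (γ : ℝ → M) (a b : ℝ), a < 0 ∧ 1 < b ∧ IsGeodesicOn g γ (Ioo a b) ∧
    (⟨γ 0, mfderiv 𝓘(ℝ, ℝ) I γ 0 (1 : ℝ)⟩ : TangentBundle I M) = v ∧ γ 1 = q

/-- The domain of the exponential map of `M`. -/
def expDomain (g : RiemMetric I M) : Set (TangentBundle I M) := {v | ∃ q, IsExp g v q}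

open Classical in
/-- The exponential map of `M` (with the irrelevant value `v.proj` outside of its domain). -/
def expMap (g : RiemMetric I M) (v : TangentBundle I M) : M :=
  if h : ∃ q, IsExp g v q then h.choose else v.proj

/-- `ν` is a normal vector of the immersion `f` at `p`. -/
def IsNormalVector (J : ModelWithCorners ℝ F G) (g : RiemMetric I M) (f : N → M) (p : N)
    (ν : TangentSpace I (f p)) : Prop :=
  ∀ w : TangentSpace J p, g.inner (f p) ν (mfderiv J I f p w) = 0

/-- The normal bundle of an immersion `f : N → M`: the pairs `(p, ν)` with `p ∈ N` and
`ν ∈ T_{f p} M` orthogonal to the image of `df_p`. It is an embedded submanifold of `N × TM`. -/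
def normalBundle (J : ModelWithCorners ℝ F G) (g : RiemMetric I M) (f : N → M) :
    Set (N × TangentBundle I M) :=
  {z | ∃ (p : N) (ν : TangentSpace I (f p)), IsNormalVector J g f p ν ∧ z = (p, ⟨f p, ν⟩)}

/-- The normal exponential map `(p, ν) ↦ exp_{f p} ν`; it is to be restricted to the normal
bundle. -/
def normalExp (N : Type*) (g : RiemMetric I M) (z : N × TangentBundle I M) : M := expMap g z.2

/-- `Φ` restricts to a diffeomorphism from the embedded submanifold `S` of `X` onto `M`: the
restriction is smooth and has a smooth inverse. -/
def IsDiffeoFrom {EX : Type*} [NormedAddCommGroup EX] [NormedSpace ℝ EX] {HX : Type*}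
    [TopologicalSpace HX] (IX : ModelWithCorners ℝ EX HX) {X : Type*} [TopologicalSpace X]
    [ChartedSpace HX X] (I : ModelWithCorners ℝ E H) (S : Set X) (Φ : X → M) : Prop :=
  ContMDiffOn IX I ∞ Φ S ∧
  ∃ Ψ : M → X, ContMDiff I IX ∞ Ψ ∧ (∀ y, Ψ y ∈ S) ∧ (∀ y, Φ (Ψ y) = y) ∧ ∀ z ∈ S, Ψ (Φ z) = z

/-- The normal exponential map is defined on the whole normal bundle of `f` and is a
diffeomorphism from it onto `M`. -/
def NormalExpIsDiffeo (J : ModelWithCorners ℝ F G) (g : RiemMetric I M) (f : N → M) : Prop :=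
  (∀ z ∈ normalBundle J g f, z.2 ∈ expDomain g) ∧
  IsDiffeoFrom (J.prod I.tangent) I (normalBundle J g f) (normalExp N g)

/-- The normal vector `z` is focal: the differential at `z` of the normal exponential map, as a
map on the normal bundle, is not injective. A tangent vector of the normal bundle at `z` is the
velocity of a smooth curve in it. -/
def IsFocal (J : ModelWithCorners ℝ F G) (g : RiemMetric I M) (f : N → M)
    (z : N × TangentBundle I M) : Prop :=
  z ∈ normalBundle J g f ∧ z.2 ∈ expDomain g ∧
  ∃ c : ℝ → N × TangentBundle I M, ContMDiff 𝓘(ℝ, ℝ) (J.prod I.tangent) ∞ c ∧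
    (∀ t, c t ∈ normalBundle J g f) ∧ c 0 = z ∧
    mfderiv 𝓘(ℝ, ℝ) (J.prod I.tangent) c 0 (1 : ℝ) ≠ 0 ∧
    mfderiv 𝓘(ℝ, ℝ) I (fun t => normalExp N g (c t)) 0 (1 : ℝ) = 0

/-- The immersion `f` is free of focal points. -/
def FreeOfFocalPoints (J : ModelWithCorners ℝ F G) (g : RiemMetric I M) (f : N → M) : Prop :=
  ∀ z, ¬ IsFocal J g f z

/-- The pairing `g(∇_u df(v), ν)` at `p`, in the charts at `p` and `f p`:
`g(∂_u ∂_v f + Γ(∂_u f, ∂_v f), ν)`. When `ν` is normal this is `g(II(u, v), ν)` with `II` the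
second fundamental form of `f`. -/
def secondFundamentalForm (J : ModelWithCorners ℝ F G) (g : RiemMetric I M) (f : N → M) (p : N)
    (u v : TangentSpace J p) (ν : TangentSpace I (f p)) : ℝ :=
  let φ : F → E := writtenInExtChartAt J I p f
  let y : E := extChartAt I (f p) (f p)
  metricInChart g (f p) y (fderiv ℝ (fderiv ℝ φ) (extChartAt J p p) u v) ν
    + christoffel g (f p) y (mfderiv J I f p u) (mfderiv J I f p v) ν

/-- `f` is a totally geodesic immersion: an immersion whose second fundamental form vanishes. -/
def IsTotallyGeodesicImmersion (J : ModelWithCorners ℝ F G) (g : RiemMetric I M) (f : N → M) :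
    Prop :=
  ContMDiff J I ∞ f ∧ (∀ p, Function.Injective (mfderiv J I f p)) ∧
  ∀ (p : N) (u v : TangentSpace J p) (ν : TangentSpace I (f p)),
    IsNormalVector J g f p ν → secondFundamentalForm J g f p u v ν = 0

/-- `X` is the gradient at `p` of the function `ρ`. -/
def IsGradientAt (g : RiemMetric I M) (ρ : M → ℝ) (p : M) (X : TangentSpace I p) : Prop :=
  ∀ w : TangentSpace I p, g.inner p X w = mfderiv I 𝓘(ℝ, ℝ) ρ p w

end Geometry

/-! ### Warped products -/

section Warped

variable {E₁ : Type*} [NormedAddCommGroup E₁] [NormedSpace ℝ E₁]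
  {H₁ : Type*} [TopologicalSpace H₁] {I₁ : ModelWithCorners ℝ E₁ H₁}
  {B : Type*} [TopologicalSpace B] [ChartedSpace H₁ B] [IsManifold I₁ ∞ B]
  {E₂ : Type*} [NormedAddCommGroup E₂] [NormedSpace ℝ E₂]
  {H₂ : Type*} [TopologicalSpace H₂] {I₂ : ModelWithCorners ℝ E₂ H₂}
  {N : Type*} [TopologicalSpace N] [ChartedSpace H₂ N] [IsManifold I₂ ∞ N]

/-- The form `π_B^* g_B + (ρ ∘ π_B)^2 π_N^* g_N` on the product `B × N`. -/
def warpedForm (gB : RiemMetric I₁ B) (gN : RiemMetric I₂ N) (ρ : B → ℝ) (x : B × N) :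
    TangentSpace (I₁.prod I₂) x →L[ℝ] TangentSpace (I₁.prod I₂) x →L[ℝ] ℝ :=
  pullbackForm (I₁.prod I₂) I₁ Prod.fst gB.inner x
    + (ρ x.1 ^ 2) • pullbackForm (I₁.prod I₂) I₂ Prod.snd gN.inner x

theorem warpedForm_apply (gB : RiemMetric I₁ B) (gN : RiemMetric I₂ N) (ρ : B → ℝ) (x : B × N)
    (u v : TangentSpace (I₁.prod I₂) x) :
    warpedForm gB gN ρ x u v
      = gB.inner x.1 u.1 v.1 + ρ x.1 ^ 2 * gN.inner x.2 u.2 v.2 := by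
  have h1 : mfderiv (I₁.prod I₂) I₁ (Prod.fst : B × N → B) x = ContinuousLinearMap.fst ℝ E₁ E₂ :=
    mfderiv_fst
  have h2 : mfderiv (I₁.prod I₂) I₂ (Prod.snd : B × N → N) x = ContinuousLinearMap.snd ℝ E₁ E₂ :=
    mfderiv_snd
  change pullbackForm (I₁.prod I₂) I₁ Prod.fst gB.inner x u v
    + (ρ x.1 ^ 2) * pullbackForm (I₁.prod I₂) I₂ Prod.snd gN.inner x u v = _
  rw [pullbackForm_apply, pullbackForm_apply, h1, h2]
  rfl

theorem warpedForm_pos (gB : RiemMetric I₁ B) (gN : RiemMetric I₂ N) (ρ : B → ℝ)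
    (hρpos : ∀ b, 0 < ρ b) (x : B × N) (v : TangentSpace (I₁.prod I₂) x) (hv : v ≠ 0) :
    0 < warpedForm gB gN ρ x v v := by
  rw [warpedForm_apply]
  have hnB : ∀ w : TangentSpace I₁ x.1, 0 ≤ gB.inner x.1 w w := fun w => by
    rcases eq_or_ne w 0 with rfl | hw
    · simp
    · exact (gB.pos _ _ hw).le
  have hnN : ∀ w : TangentSpace I₂ x.2, 0 ≤ gN.inner x.2 w w := fun w => by
    rcases eq_or_ne w 0 with rfl | hw
    · simp
    · exact (gN.pos _ _ hw).le
  have hr : 0 < ρ x.1 ^ 2 := pow_pos (hρpos _) 2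
  by_cases h : (v.1 : E₁) = 0
  · have h2 : (v.2 : E₂) ≠ 0 := fun h' => hv (Prod.ext h h')
    exact add_pos_of_nonneg_of_pos (hnB _) (mul_pos hr (gN.pos x.2 v.2 h2))
  · exact add_pos_of_pos_of_nonneg (gB.pos x.1 v.1 h) (mul_nonneg hr.le (hnN _))

/-- The warped product metric on `B × N`. -/
def warpedProduct [FiniteDimensional ℝ E₁] [FiniteDimensional ℝ E₂]
    (gB : RiemMetric I₁ B) (gN : RiemMetric I₂ N) (ρ : B → ℝ)
    (hρ : ContMDiff I₁ 𝓘(ℝ, ℝ) ∞ ρ) (hρpos : ∀ b, 0 < ρ b) :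
    RiemMetric (I₁.prod I₂) (B × N) where
  inner := warpedForm gB gN ρ
  symm x v w := by
    rw [warpedForm_apply, warpedForm_apply]
    exact congrArg₂ (fun a b => a + ρ x.1 ^ 2 * b) (gB.symm x.1 v.1 w.1) (gN.symm x.2 v.2 w.2)
  pos := warpedForm_pos gB gN ρ hρpos
  isVonNBounded x := isVonNBounded_of_posDef (E := E₁ × E₂) (warpedForm gB gN ρ x)
    (warpedForm_pos gB gN ρ hρpos x)
  contMDiff := by
    have h1 := contMDiff_pullbackForm (I := I₁.prod I₂)
      (contMDiff_fst (I := I₁) (J := I₂) (M := B) (N := N) (n := ∞)) gB.contMDiff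
    have h2 := contMDiff_pullbackForm (I := I₁.prod I₂)
      (contMDiff_snd (I := I₁) (J := I₂) (M := B) (N := N) (n := ∞)) gN.contMDiff
    have h3 : ContMDiff (I₁.prod I₂) 𝓘(ℝ, ℝ) ∞ (fun x : B × N => ρ x.1 ^ 2) :=
      (hρ.comp contMDiff_fst).pow 2
    exact h1.add_section (h3.smul_section h2)

end Warped

/-! ### Rotationally symmetric metrics on a Euclidean space -/

section Polar

variable {V : Type*} [NormedAddCommGroup V] [InnerProductSpace ℝ V]

/-- The one-form `dr` of `r(x) = ‖x‖` at a point `x ≠ 0`: `dr(v) = ⟪x, v⟫ / ‖x‖`. -/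
def radialForm (x : V) : V →L[ℝ] ℝ := ‖x‖⁻¹ • innerSL ℝ x

/-- The Euclidean inner product, as a bilinear form. -/
def euclideanForm : V →L[ℝ] V →L[ℝ] ℝ := innerSL ℝ

theorem euclideanForm_apply (v w : V) : euclideanForm v w = inner ℝ v w := rfl

/-- The form `dr^2` at a point `x ≠ 0`. -/
def radialSqForm (x : V) : V →L[ℝ] V →L[ℝ] ℝ := (radialForm x).smulRight (radialForm x)

/-- The form `dθ^2` at a point `x ≠ 0`, the pullback of the metric of the unit sphere under
`x ↦ x / ‖x‖`; it is determined by `⟪v, w⟫ = dr(v) dr(w) + r^2 dθ^2(v, w)`. -/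
def angularForm (x : V) : V →L[ℝ] V →L[ℝ] ℝ :=
  (‖x‖ ^ 2)⁻¹ • (euclideanForm - radialSqForm x)

open Classical in
/-- The metric `dr^2 + σ(r)^2 dθ^2`. Its value at the origin is the Euclidean one, which is the
only value that makes it continuous there when `σ(0) = 0` and `σ'(0) = 1`. -/
def polarForm (σ : ℝ → ℝ) (x : V) : V →L[ℝ] V →L[ℝ] ℝ :=
  if x = 0 then euclideanForm else radialSqForm x + (σ ‖x‖ ^ 2) • angularForm x

theorem polarForm_apply (σ : ℝ → ℝ) {x : V} (hx : x ≠ 0) (v w : V) :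
    polarForm σ x v w = ‖x‖⁻¹ * inner ℝ x v * (‖x‖⁻¹ * inner ℝ x w)
      + σ ‖x‖ ^ 2 * ((‖x‖ ^ 2)⁻¹ *
        (inner ℝ v w - ‖x‖⁻¹ * inner ℝ x v * (‖x‖⁻¹ * inner ℝ x w))) := by
  simp [polarForm, hx, radialSqForm, angularForm, radialForm, euclideanForm_apply]

theorem polarForm_zero (σ : ℝ → ℝ) (v w : V) : polarForm σ 0 v w = inner ℝ v w := by
  simp [polarForm, euclideanForm_apply]

theorem polarForm_symm (σ : ℝ → ℝ) (x v w : V) : polarForm σ x v w = polarForm σ x w v := by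
  rcases eq_or_ne x 0 with rfl | hx
  · rw [polarForm_zero, polarForm_zero, real_inner_comm]
  · rw [polarForm_apply σ hx, polarForm_apply σ hx, real_inner_comm v w]
    ring

theorem polarForm_pos (σ : ℝ → ℝ) (hσpos : ∀ r, 0 < r → 0 < σ r) (x v : V) (hv : v ≠ 0) :
    0 < polarForm σ x v v := by
  rcases eq_or_ne x 0 with rfl | hx
  · rw [polarForm_zero]
    exact real_inner_self_pos.2 hv
  have hn : 0 < ‖x‖ := norm_pos_iff.2 hx
  have hs : 0 < σ ‖x‖ ^ 2 := pow_pos (hσpos _ hn) 2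
  rw [polarForm_apply σ hx]
  set a : ℝ := ‖x‖⁻¹ * inner ℝ x v with ha
  have hv2 : 0 < inner ℝ v v := real_inner_self_pos.2 hv
  have hcs : a * a ≤ inner ℝ v v := by
    have h1 := real_inner_mul_inner_self_le x v
    rw [real_inner_self_eq_norm_sq x] at h1
    have h2 : a * a = (‖x‖ ^ 2)⁻¹ * (inner ℝ x v * inner ℝ x v) := by
      rw [ha]
      field_simp
    rw [h2, inv_mul_le_iff₀ (by positivity)]
    exact h1
  have hi : 0 < (‖x‖ ^ 2)⁻¹ := by positivity
  rcases eq_or_ne a 0 with h0 | h0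
  · rw [h0]
    simp only [mul_zero, sub_zero, zero_add]
    positivity
  · have h3 : 0 < a * a := mul_self_pos.2 h0
    have h4 : 0 ≤ σ ‖x‖ ^ 2 * ((‖x‖ ^ 2)⁻¹ * (inner ℝ v v - a * a)) :=
      mul_nonneg hs.le (mul_nonneg hi.le (sub_nonneg.2 hcs))
    linarith

/-- The Riemannian metric `dr^2 + σ(r)^2 dθ^2`, provided that it is smooth at the origin. -/
def polarMetric [FiniteDimensional ℝ V] (σ : ℝ → ℝ) (hσpos : ∀ r, 0 < r → 0 < σ r)
    (hsm : ContDiff ℝ ∞ (polarForm σ : V → V →L[ℝ] V →L[ℝ] ℝ)) : RiemMetric 𝓘(ℝ, V) V where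
  inner x := polarForm (V := V) σ x
  symm x v w := polarForm_symm (V := V) σ x v w
  pos x v hv := polarForm_pos (V := V) σ hσpos x v hv
  isVonNBounded x := isVonNBounded_of_posDef (E := V) (polarForm σ x)
    (polarForm_pos (V := V) σ hσpos x)
  contMDiff := by
    intro x₀
    refine (contMDiffAt_hom_bundle _).2 ⟨contMDiffAt_id, ?_⟩
    refine hsm.contMDiff.contMDiffAt.congr_of_eventuallyEq (Filter.Eventually.of_forall fun x => ?_)
    ext v w
    refine (inCoordinates_apply_eq₂ (mem_univ _) (mem_univ _)
      (mem_univ _)).trans ?_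
    have h : ∀ u : V, (trivializationAt V (TangentSpace 𝓘(ℝ, V)) x₀).symm x u = u := fun u => by
      rw [← (trivializationAt V (TangentSpace 𝓘(ℝ, V)) x₀).symmL_apply (R := ℝ) (mem_univ x)]
      exact congrArg (fun L : V →L[ℝ] V => L u)
        (TangentBundle.symmL_model_space (𝕜 := ℝ) (F := V) x₀ x)
    rw [h, h]
    simp
    rfl

end Polar

end

/-!
Write `V = ℝ^{n+1}`, `S ⊂ V` for the unit sphere and `G` for the metric `dr² + σ(r)² dθ²` on `V`.
In the product of the identity of `V` with a chart of `N'` the warped product metric is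
`G + ρ² g_{N'}`, so its Christoffel symbols are sums of derivatives of `G`, of `ρ²` and of `g_{N'}`
(`metricInChart_warpedProduct`, `fderiv_metricInChart_warpedProduct`).

The computations in `V` all rest on the identity `G_x(x, w) = ⟪x, w⟫` (`polarForm_self_left`), which
says that the radial direction has unit speed and is orthogonal to the spheres, and on its derivative
`(∂_w G)_x(x, u) + G_x(w, u) = ⟪w, u⟫` (`fderiv_polarForm_add`). Evaluated on a line through the
origin, the latter gives `(∂_ν G)(ν, u) = 0 = (∂_w G)(ν, ν)` at `t ν`, so that `t ↦ (t ν, p)` is a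
geodesic of the warped product (`isGeodesicOn_radial`).

The normal space of `{0} × N'` at `(0, p)` is `T_0 V`, so the normal exponential map is
`(p, (ν, 0)) ↦ (ν, p)`. That its value, defined as the endpoint of some geodesic, is the endpoint of
the line above is the uniqueness of geodesics (`IsExp.unique`): in a chart, position and velocity
solve a first order equation with a `C¹` right hand side, and the set of times near which two
geodesics agree is open and closed. The resulting formula is visibly a diffeomorphism
(`normalExpIsDiffeo_slice`), and a diffeomorphism has injective differential
(`NormalExpIsDiffeo.freeOfFocalPoints`).

The normal space of `S × N'` at `(x, p)` is spanned by `x`. If `u`, `v` are tangent to `S` at `x`,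
then `⟪D²s(u, v), x⟫ = -⟪u, v⟫` for a parametrization `s` of `S`, while
`g(Γ(u, v), x) = (1 - σ(1)²) ⟪u, v⟫ + σ(1)² ⟪u, v⟫`, where the last term is `-1/2` times the radial
derivative of `σ(r)² / r²` at `r = 1` and uses `σ'(1) = 0`; the two cancel (`christoffel_sphere_radial`,
`isTotallyGeodesicImmersion_sphere`). The term `-(1/2) ∂_x(ρ²) g_{N'}` vanishes because `∇ρ` is
tangent to `S` (`fderiv_radial_eq_zero_of_gradient_tangent`).
-/

/-! ### Smoothness of pulled back forms -/

section PullbackSmooth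

variable {E : Type*} [NormedAddCommGroup E] [NormedSpace ℝ E]
  {H : Type*} [TopologicalSpace H] {I : ModelWithCorners ℝ E H}
  {M : Type*} [TopologicalSpace M] [ChartedSpace H M]
  {E' : Type*} [NormedAddCommGroup E'] [NormedSpace ℝ E']
  {H' : Type*} [TopologicalSpace H'] {I' : ModelWithCorners ℝ E' H'}
  {M' : Type*} [TopologicalSpace M'] [ChartedSpace H' M']

/-- The local form of `contMDiff_pullbackForm`; charts are only locally defined maps. -/
theorem contMDiffAt_pullbackForm [IsManifold I ∞ M] [IsManifold I' ∞ M'] {f : M → M'} {x₀ : M}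
    (hf : ContMDiffAt I I' ∞ f x₀)
    {b : ∀ y : M', TangentSpace I' y →L[ℝ] TangentSpace I' y →L[ℝ] ℝ}
    (hb : ContMDiff I' (I'.prod 𝓘(ℝ, E' →L[ℝ] E' →L[ℝ] ℝ)) ∞
      (fun y => TotalSpace.mk' (E' →L[ℝ] E' →L[ℝ] ℝ) y (b y))) :
    ContMDiffAt I (I.prod 𝓘(ℝ, E →L[ℝ] E →L[ℝ] ℝ)) ∞
      (fun x => TotalSpace.mk' (E →L[ℝ] E →L[ℝ] ℝ) x (pullbackForm I I' f b x)) x₀ := by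
  have h1 := (contMDiffAt_hom_bundle _).1 (hb (f x₀))
  rw [contMDiffAt_hom_bundle]
  refine ⟨contMDiffAt_id, ?_⟩
  have h2 := (h1.2.comp x₀ hf)
  have h3 := ContMDiffAt.mfderiv_const (m := ∞) hf (by simp)
  have h4 := contMDiffAt_flip ((contMDiffAt_flip (h2.clm_comp h3)).clm_comp h3)
  refine ContMDiffAt.congr_of_eventuallyEq h4 ?_
  have hx₀ : ∀ᶠ x in 𝓝 x₀, x ∈ (chartAt H x₀).source :=
    (chartAt H x₀).open_source.mem_nhds (mem_chart_source H x₀)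
  have hfx₀ : ∀ᶠ x in 𝓝 x₀, f x ∈ (chartAt H' (f x₀)).source :=
    hf.continuousAt.eventually
      ((chartAt H' (f x₀)).open_source.mem_nhds (mem_chart_source H' (f x₀)))
  filter_upwards [hx₀, hfx₀] with x hx hfx
  ext u v
  have hx' : x ∈ (trivializationAt E (TangentSpace I) x₀).baseSet := hx
  have hfx' : f x ∈ (trivializationAt E' (TangentSpace I') (f x₀)).baseSet := hfx
  have hA : ∀ w : E, (trivializationAt E' (TangentSpace I') (f x₀)).symm (f x)
      (inTangentCoordinates I I' id f (fun x => mfderiv I I' f x) x₀ x w)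
      = mfderiv I I' f x ((trivializationAt E (TangentSpace I) x₀).symm x w) := by
    intro w
    have h := ContinuousLinearMap.inCoordinates_eq (ϕ := mfderiv I I' f x) hx' hfx'
    change (trivializationAt E' (TangentSpace I') (f x₀)).symm (f x)
      (ContinuousLinearMap.inCoordinates E (TangentSpace I) E' (TangentSpace I') x₀ x (f x₀) (f x)
        (mfderiv I I' f x) w) = _
    rw [h]
    simp only [ContinuousLinearMap.coe_comp, ContinuousLinearEquiv.coe_coe, Function.comp_apply]
    exact ((trivializationAt E' (TangentSpace I') (f x₀)).continuousLinearEquivAt ℝ (f x)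
      hfx').symm_apply_apply _
  rw [inCoordinates_apply_eq₂ hx' hx' (Set.mem_univ _)]
  simp only [Function.comp_apply, ContinuousLinearMap.flip_apply, ContinuousLinearMap.coe_comp]
  rw [inCoordinates_apply_eq₂ hfx' hfx' (Set.mem_univ _), hA, hA]
  rfl

/-- On a vector space, where the tangent bundle is trivial, a smooth section of the bundle of
bilinear forms is a smooth function. -/
theorem contDiffAt_of_contMDiffAt_form {b : E → E →L[ℝ] E →L[ℝ] ℝ} {x₀ : E}
    (hb : ContMDiffAt 𝓘(ℝ, E) (𝓘(ℝ, E).prod 𝓘(ℝ, E →L[ℝ] E →L[ℝ] ℝ)) ∞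
      (fun x => (TotalSpace.mk' (E →L[ℝ] E →L[ℝ] ℝ) x (b x) :
        TotalSpace (E →L[ℝ] E →L[ℝ] ℝ) (fun x : E => TangentSpace 𝓘(ℝ, E) x →L[ℝ]
          TangentSpace 𝓘(ℝ, E) x →L[ℝ] ℝ))) x₀) :
    ContDiffAt ℝ ∞ b x₀ := by
  have h := ((contMDiffAt_hom_bundle _).1 hb).2
  refine (h.congr_of_eventuallyEq (Filter.Eventually.of_forall fun x => ?_)).contDiffAt
  symm
  ext v w
  refine (inCoordinates_apply_eq₂ (mem_univ _) (mem_univ _) (mem_univ _)).trans ?_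
  have h : ∀ u : E, (trivializationAt E (TangentSpace 𝓘(ℝ, E)) x₀).symm x u = u := fun u => by
    rw [← (trivializationAt E (TangentSpace 𝓘(ℝ, E)) x₀).symmL_apply (R := ℝ) (mem_univ x)]
    exact congrArg (fun L : E →L[ℝ] E => L u)
      (TangentBundle.symmL_model_space (𝕜 := ℝ) (F := E) x₀ x)
  rw [h, h]
  simp
  rfl

end PullbackSmooth

/-! ### Uniqueness of geodesics -/

section Uniqueness

variable {E : Type*} [NormedAddCommGroup E] [NormedSpace ℝ E]
  {H : Type*} [TopologicalSpace H] {I : ModelWithCorners ℝ E H}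
  {M : Type*} [TopologicalSpace M] [ChartedSpace H M]

/-- In the chart at `γ t`, the velocity of `γ` at time `t` is the derivative of the coordinates. -/
theorem mfderiv_one_eq_deriv {γ : ℝ → M} {t : ℝ} (hγ : MDifferentiableAt 𝓘(ℝ, ℝ) I γ t) :
    mfderiv 𝓘(ℝ, ℝ) I γ t (1 : ℝ) = deriv (fun s => extChartAt I (γ t) (γ s)) t := by
  rw [hγ.mfderiv]
  simp only [mfld_simps]
  rw [fderivWithin_univ]
  exact fderiv_apply_one_eq_deriv (𝕜 := ℝ) (f := fun s => I (chartAt H (γ t) (γ s)))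

variable [IsManifold I ∞ M]

theorem contDiffAt_metricInChart [I.Boundaryless] (g : RiemMetric I M) (x₀ : M) {y : E}
    (hy : y ∈ (extChartAt I x₀).target) : ContDiffAt ℝ ∞ (metricInChart g x₀) y := by
  refine contDiffAt_of_contMDiffAt_form (contMDiffAt_pullbackForm ?_ g.contMDiff)
  exact (contMDiffOn_extChartAt_symm x₀).contMDiffAt ((isOpen_extChartAt_target x₀).mem_nhds hy)

theorem metricInChart_apply (g : RiemMetric I M) (x₀ : M) (y u v : E) :
    metricInChart g x₀ y u v = g.inner ((extChartAt I x₀).symm y)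
      (mfderiv 𝓘(ℝ, E) I (extChartAt I x₀).symm y u)
      (mfderiv 𝓘(ℝ, E) I (extChartAt I x₀).symm y v) := rfl

theorem metricInChart_pos [I.Boundaryless] (g : RiemMetric I M) (x₀ : M) {y : E}
    (hy : y ∈ (extChartAt I x₀).target) {v : E} (hv : v ≠ 0) :
    0 < metricInChart g x₀ y v v := by
  have : IsManifold I 1 M := IsManifold.of_le (n := ∞) (by simp)
  rw [metricInChart_apply]
  refine g.pos _ _ fun h => hv ?_
  have hi := isInvertible_mfderivWithin_extChartAt_symm hy
  rw [I.range_eq_univ, mfderivWithin_univ] at hi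
  exact hi.injective (h.trans (map_zero _).symm)

/-- The form `metricInChart` as an isomorphism from vectors to covectors. -/
theorem exists_continuousLinearEquiv_metricInChart [I.Boundaryless] [FiniteDimensional ℝ E]
    (g : RiemMetric I M) (x₀ : M) {y : E} (hy : y ∈ (extChartAt I x₀).target) :
    ∃ e : E ≃L[ℝ] (E →L[ℝ] ℝ), (e : E →L[ℝ] E →L[ℝ] ℝ) = metricInChart g x₀ y := by
  have hinj : Function.Injective
      ((metricInChart g x₀ y : E →L[ℝ] E →L[ℝ] ℝ) : E →ₗ[ℝ] E →L[ℝ] ℝ) := by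
    rw [← LinearMap.ker_eq_bot, LinearMap.ker_eq_bot']
    intro v hv
    by_contra hne
    have h := metricInChart_pos g x₀ hy hne
    have h0 : metricInChart g x₀ y v = 0 := hv
    rw [h0] at h
    simp at h
  have hd : Module.finrank ℝ E = Module.finrank ℝ (E →L[ℝ] ℝ) := by
    rw [← (LinearMap.toContinuousLinearMap (𝕜 := ℝ) (E := E) (F' := ℝ)).finrank_eq]
    exact (Subspace.dual_finrank_eq (K := ℝ) (V := E)).symm
  exact ⟨(LinearMap.linearEquivOfInjective _ hinj hd).toContinuousLinearEquiv, rfl⟩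

/-- `christoffel g x₀ y p p` as a covector. -/
noncomputable def christoffelCovector (g : RiemMetric I M) (x₀ : M) (y p : E) : E →L[ℝ] ℝ :=
  fderiv ℝ (metricInChart g x₀) y p p
    - (1 / 2 : ℝ) • ((fderiv ℝ (metricInChart g x₀) y).flip p).flip p

theorem christoffelCovector_apply (g : RiemMetric I M) (x₀ : M) (y p w : E) :
    christoffelCovector g x₀ y p w = christoffel g x₀ y p p w := by
  simp [christoffelCovector, christoffel]
  ring

/-- The vector field on `E × E` whose integral curves are the geodesics in the chart at `x₀`
together with their velocities. -/
noncomputable def geodesicField (g : RiemMetric I M) (x₀ : M) (z : E × E) : E × E :=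
  (z.2, -(ContinuousLinearMap.inverse (metricInChart g x₀ z.1)
    (christoffelCovector g x₀ z.1 z.2)))

set_option synthInstance.maxHeartbeats 200000 in
set_option maxSynthPendingDepth 3 in
theorem contDiffAt_geodesicField [I.Boundaryless] [FiniteDimensional ℝ E]
    (g : RiemMetric I M) (x₀ : M) {z : E × E} (hz : z.1 ∈ (extChartAt I x₀).target) :
    ContDiffAt ℝ 1 (geodesicField g x₀) z := by
  have : CompleteSpace E := FiniteDimensional.complete ℝ E
  have hU : IsOpen {z : E × E | z.1 ∈ (extChartAt I x₀).target} :=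
    (isOpen_extChartAt_target x₀).preimage continuous_fst
  have hC : ContDiffAt ℝ ∞ (fun z : E × E => christoffelCovector g x₀ z.1 z.2) z := by
    refine ContDiffOn.contDiffAt ?_ (hU.mem_nhds hz)
    rw [contDiffOn_clm_apply]
    intro w z hz
    refine ContDiffAt.contDiffWithinAt ?_
    have hsnd : ContDiffAt ℝ ∞ (Prod.snd : E × E → E) z := contDiffAt_snd
    have hD : ContDiffAt ℝ ∞ (fun z : E × E => fderiv ℝ (metricInChart g x₀) z.1) z :=
      ((contDiffAt_metricInChart g x₀ hz).fderiv_right (m := ∞) (by simp)).comp z contDiffAt_fst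
    simp only [christoffelCovector, sub_apply, smul_apply, ContinuousLinearMap.flip_apply,
      smul_eq_mul]
    exact (((hD.clm_apply hsnd).clm_apply hsnd).clm_apply contDiffAt_const).sub
      (contDiffAt_const.mul (((hD.clm_apply contDiffAt_const).clm_apply hsnd).clm_apply hsnd))
  obtain ⟨e, he⟩ := exists_continuousLinearEquiv_metricInChart g x₀ hz
  have hinv := contDiffAt_map_inverse (𝕜 := ℝ) (n := ∞) e
  rw [he] at hinv
  have hI : ContDiffAt ℝ ∞
      (fun z : E × E => ContinuousLinearMap.inverse (metricInChart g x₀ z.1)) z :=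
    ContDiffAt.comp (g := ContinuousLinearMap.inverse) z hinv
      ((contDiffAt_metricInChart g x₀ hz).comp z contDiffAt_fst)
  exact (contDiffAt_snd.prodMk (hI.clm_apply hC).neg).of_le (by simp)

/-- A curve which is smooth near `t` is smooth near `t` in every chart around `γ t`. -/
theorem contDiffAt_extChartAt_comp {γ : ℝ → M} {t : ℝ} (x₀ : M)
    (hγ : ContMDiffAt 𝓘(ℝ, ℝ) I ∞ γ t) (ht : γ t ∈ (chartAt H x₀).source) :
    ContDiffAt ℝ ∞ (fun s => extChartAt I x₀ (γ s)) t :=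
  ((contMDiffAt_extChartAt' (n := ∞) ht).comp t hγ).contDiffAt

theorem ContDiffAt.deriv_of_infty {c : ℝ → E} {t : ℝ} (hc : ContDiffAt ℝ ∞ c t) :
    ContDiffAt ℝ ∞ (deriv c) t :=
  (hc.fderiv_right (m := ∞) (by simp)).clm_apply contDiffAt_const

theorem IsGeodesicOn.contMDiffAt {g : RiemMetric I M} {γ : ℝ → M} {T : Set ℝ}
    (hγ : IsGeodesicOn g γ T) (hT : IsOpen T) {t : ℝ} (ht : t ∈ T) :
    ContMDiffAt 𝓘(ℝ, ℝ) I ∞ γ t :=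
  (hγ.1 t ht).contMDiffAt (hT.mem_nhds ht)

theorem IsGeodesicOn.hasDerivAt_geodesicField [I.Boundaryless] [FiniteDimensional ℝ E]
    {g : RiemMetric I M} {γ : ℝ → M} {T : Set ℝ} (hγ : IsGeodesicOn g γ T) (hT : IsOpen T)
    {x₀ : M} {t : ℝ} (ht : t ∈ T) (hx : γ t ∈ (chartAt H x₀).source) :
    HasDerivAt (fun s => (extChartAt I x₀ (γ s), deriv (fun s => extChartAt I x₀ (γ s)) s))
      (geodesicField g x₀ (extChartAt I x₀ (γ t), deriv (fun s => extChartAt I x₀ (γ s)) t)) t := by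
  set c : ℝ → E := fun s => extChartAt I x₀ (γ s) with hc_def
  have hc : ContDiffAt ℝ ∞ c t := contDiffAt_extChartAt_comp x₀ (hγ.contMDiffAt hT ht) hx
  have h1 : HasDerivAt c (deriv c t) t := (hc.differentiableAt (by simp)).hasDerivAt
  have h2 : HasDerivAt (deriv c) (deriv (deriv c) t) t :=
    (hc.deriv_of_infty.differentiableAt (by simp)).hasDerivAt
  refine (h1.prodMk h2).congr_deriv ?_
  have hy : c t ∈ (extChartAt I x₀).target :=
    (extChartAt I x₀).map_source (by rwa [extChartAt_source])
  obtain ⟨e, he⟩ := exists_continuousLinearEquiv_metricInChart g x₀ hy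
  refine Prod.ext rfl ?_
  simp only [geodesicField]
  rw [← he, ContinuousLinearMap.inverse_equiv]
  refine eq_neg_of_add_eq_zero_left ?_
  -- Lower the index: the geodesic equation is an equation between covectors.
  apply e.injective
  rw [map_add, map_zero]
  ext w
  have h : metricInChart g x₀ (c t) (deriv (deriv c) t) w
    + christoffel g x₀ (c t) (deriv c t) (deriv c t) w = 0 := hγ.2 x₀ t ht hx w
  rw [← christoffelCovector_apply, ← he] at h
  simpa [hc_def] using h

/-- Two geodesics with the same position and velocity at time `t₀` agree near `t₀`. -/
theorem IsGeodesicOn.eventuallyEq [I.Boundaryless] [FiniteDimensional ℝ E]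
    {g : RiemMetric I M} {γ γ' : ℝ → M} {T : Set ℝ} (hγ : IsGeodesicOn g γ T)
    (hγ' : IsGeodesicOn g γ' T) (hT : IsOpen T) {t₀ : ℝ} (ht : t₀ ∈ T) (h0 : γ t₀ = γ' t₀)
    (h1 : deriv (fun s => extChartAt I (γ t₀) (γ s)) t₀
      = deriv (fun s => extChartAt I (γ t₀) (γ' s)) t₀) : γ =ᶠ[𝓝 t₀] γ' := by
  set x₀ : M := γ t₀ with hx₀
  have hsrc : (chartAt H x₀).source ∈ 𝓝 x₀ := chart_source_mem_nhds H x₀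
  have hm : ∀ᶠ t in 𝓝 t₀, γ t ∈ (chartAt H x₀).source :=
    (hγ.contMDiffAt hT ht).continuousAt.eventually hsrc
  have hm' : ∀ᶠ t in 𝓝 t₀, γ' t ∈ (chartAt H x₀).source :=
    (hγ'.contMDiffAt hT ht).continuousAt.eventually (by rwa [← h0])
  set f : ℝ → E × E :=
    fun s => (extChartAt I x₀ (γ s), deriv (fun s => extChartAt I x₀ (γ s)) s) with hf
  set f' : ℝ → E × E :=
    fun s => (extChartAt I x₀ (γ' s), deriv (fun s => extChartAt I x₀ (γ' s)) s) with hf'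
  have hff' : f t₀ = f' t₀ := Prod.ext (congrArg (extChartAt I x₀) h0) h1
  have hTn : ∀ᶠ t in 𝓝 t₀, t ∈ T := hT.mem_nhds ht
  have hd : ∀ᶠ t in 𝓝 t₀, HasDerivAt f (geodesicField g x₀ (f t)) t := by
    filter_upwards [hTn, hm] with t h h' using hγ.hasDerivAt_geodesicField hT h h'
  have hd' : ∀ᶠ t in 𝓝 t₀, HasDerivAt f' (geodesicField g x₀ (f' t)) t := by
    filter_upwards [hTn, hm'] with t h h' using hγ'.hasDerivAt_geodesicField hT h h'
  have hz : (f t₀).1 ∈ (extChartAt I x₀).target := mem_extChartAt_target x₀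
  obtain ⟨K, s, hs, hK⟩ := (contDiffAt_geodesicField g x₀ hz).exists_lipschitzOnWith
  have hfs : ∀ᶠ t in 𝓝 t₀, f t ∈ s := hd.self_of_nhds.continuousAt.eventually hs
  have hfs' : ∀ᶠ t in 𝓝 t₀, f' t ∈ s :=
    hd'.self_of_nhds.continuousAt.eventually (by rwa [← hff'])
  have key : f =ᶠ[𝓝 t₀] f' :=
    ODE_solution_unique_of_eventually (v := fun _ => geodesicField g x₀) (s := fun _ => s)
      (Filter.Eventually.of_forall fun _ => hK) (hd.and hfs) (hd'.and hfs') hff'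
  filter_upwards [key, hm, hm'] with t hk h h'
  refine (extChartAt I x₀).injOn ?_ ?_ (congrArg Prod.fst hk)
  · rwa [extChartAt_source]
  · rwa [extChartAt_source]

/-- Two geodesics on an interval with the same initial position and velocity agree: the set of
times near which they agree is open, nonempty, and closed in the interval. -/
theorem IsGeodesicOn.eqOn_Ioo [I.Boundaryless] [FiniteDimensional ℝ E] [T2Space M]
    {g : RiemMetric I M} {γ γ' : ℝ → M} {a b : ℝ} (hγ : IsGeodesicOn g γ (Ioo a b))
    (hγ' : IsGeodesicOn g γ' (Ioo a b)) {t₀ : ℝ} (ht : t₀ ∈ Ioo a b) (h0 : γ t₀ = γ' t₀)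
    (h1 : deriv (fun s => extChartAt I (γ t₀) (γ s)) t₀
      = deriv (fun s => extChartAt I (γ t₀) (γ' s)) t₀) : EqOn γ γ' (Ioo a b) := by
  suffices hsub : Ioo a b ⊆ {t | γ =ᶠ[𝓝 t] γ'} from fun t h => (hsub h).self_of_nhds
  refine isPreconnected_Ioo.subset_of_closure_inter_subset isOpen_setOfPred_eventually_nhds
    ⟨t₀, ht, hγ.eventuallyEq hγ' isOpen_Ioo ht h0 h1⟩ ?_
  rintro t ⟨htc, hti⟩
  have hfr : ∃ᶠ s in 𝓝 t, γ =ᶠ[𝓝 s] γ' := mem_closure_iff_frequently.1 htc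
  have hc := hγ.contMDiffAt isOpen_Ioo hti
  have hc' := hγ'.contMDiffAt isOpen_Ioo hti
  have h0 : γ t = γ' t := tendsto_nhds_unique_of_frequently_eq hc.continuousAt hc'.continuousAt
    (hfr.mono fun s hs => hs.self_of_nhds)
  refine hγ.eventuallyEq hγ' isOpen_Ioo hti h0 ?_
  have hx : γ t ∈ (chartAt H (γ t)).source := mem_chart_source H (γ t)
  have hd := (contDiffAt_extChartAt_comp _ hc hx).deriv_of_infty.continuousAt
  have hd' := (contDiffAt_extChartAt_comp (γ t) hc' (by rwa [← h0])).deriv_of_infty.continuousAt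
  exact tendsto_nhds_unique_of_frequently_eq hd hd' (hfr.mono fun s hs =>
    (hs.fun_comp (extChartAt I (γ t))).deriv_eq)

theorem IsExp.unique [I.Boundaryless] [FiniteDimensional ℝ E] [T2Space M]
    {g : RiemMetric I M} {v : TangentBundle I M} {q q' : M} (h : IsExp g v q)
    (h' : IsExp g v q') : q = q' := by
  obtain ⟨γ, a, b, ha, hb, hγ, hv, rfl⟩ := h
  obtain ⟨γ', a', b', ha', hb', hγ', hv', rfl⟩ := h'
  have mono : ∀ {γ : ℝ → M} {S T : Set ℝ}, S ⊆ T → IsGeodesicOn g γ T → IsGeodesicOn g γ S :=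
    fun hST h => ⟨h.1.mono hST, fun x₀ t ht => h.2 x₀ t (hST ht)⟩
  have hγm := mono (Ioo_subset_Ioo (le_max_left a a') (min_le_left b b')) hγ
  have hγm' := mono (Ioo_subset_Ioo (le_max_right a a') (min_le_right b b')) hγ'
  have h0m : (0 : ℝ) ∈ Ioo (max a a') (min b b') :=
    ⟨max_lt ha ha', lt_min (by linarith) (by linarith)⟩
  have h1m : (1 : ℝ) ∈ Ioo (max a a') (min b b') :=
    ⟨max_lt (by linarith) (by linarith), lt_min hb hb'⟩
  have hvv := hv.trans hv'.symm
  have h0 : γ 0 = γ' 0 := congrArg TotalSpace.proj hvv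
  refine hγm.eqOn_Ioo hγm' h0m h0 ?_ h1m
  have hd := mfderiv_one_eq_deriv
    ((hγm.contMDiffAt isOpen_Ioo h0m).mdifferentiableAt (by simp))
  have hd' := mfderiv_one_eq_deriv
    ((hγm'.contMDiffAt isOpen_Ioo h0m).mdifferentiableAt (by simp))
  rw [← h0] at hd'
  rw [← hd, ← hd']
  have : ∀ {z z' : TangentBundle I M}, z = z' → (z.2 : E) = z'.2 := by
    rintro z _ rfl; rfl
  exact this hvv

/-- The exponential map takes the value of any geodesic with the given initial velocity. -/
theorem IsExp.expMap_eq [I.Boundaryless] [FiniteDimensional ℝ E] [T2Space M]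
    {g : RiemMetric I M} {v : TangentBundle I M} {q : M} (h : IsExp g v q) :
    expMap g v = q := by
  have hex : ∃ q, IsExp g v q := ⟨q, h⟩
  rw [expMap, dif_pos hex]
  exact hex.choose_spec.unique h

end Uniqueness

/-! ### The polar form along radial lines -/

section PolarDeriv

variable {V : Type*} [NormedAddCommGroup V] [InnerProductSpace ℝ V]

/-- The radial direction is of unit speed and orthogonal to the spheres. -/
theorem polarForm_self_left (σ : ℝ → ℝ) (x w : V) : polarForm σ x x w = inner ℝ x w := by
  rcases eq_or_ne x 0 with rfl | hx
  · rw [polarForm_zero]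
  · have hn : ‖x‖ ≠ 0 := norm_ne_zero_iff.2 hx
    rw [polarForm_apply σ hx, real_inner_self_eq_norm_sq]
    field_simp
    ring

/-- The derivative of `polarForm_self_left` in the base point. -/
theorem fderiv_polarForm_add {σ : ℝ → ℝ}
    (hsm : ContDiff ℝ ∞ (polarForm σ : V → V →L[ℝ] V →L[ℝ] ℝ)) (y w u : V) :
    fderiv ℝ (polarForm σ) y w y u + polarForm σ y w u = inner ℝ w u := by
  have hd : HasFDerivAt (polarForm σ) (fderiv ℝ (polarForm σ) y) y :=
    (hsm.differentiable (by simp) y).hasFDerivAt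
  have h1 := (hd.clm_apply (hasFDerivAt_id y)).clm_apply (hasFDerivAt_const u y)
  have h2 : HasFDerivAt (fun x : V => inner ℝ x u) ((innerSL ℝ).flip u) y :=
    ((innerSL ℝ).flip u).hasFDerivAt
  have h3 : (fun x : V => polarForm σ (id x) (id x) u) = fun x : V => inner ℝ x u :=
    funext fun x => polarForm_self_left σ x u
  have h4 := congrArg (fun L : V →L[ℝ] ℝ => L w) (h1.unique (h3 ▸ h2))
  have h5 : fderiv ℝ (polarForm σ) y w y u + polarForm σ y w u = innerSL ℝ u w := by
    rw [innerSL_apply_apply]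
    simpa [add_comm] using h4.trans (real_inner_comm u w)
  exact h5.trans (real_inner_comm w u)

set_option synthInstance.maxHeartbeats 200000 in
/-- Together with `fderiv_polarForm_transverse_line` this makes the lines through the origin
geodesics. The point `t = 0` is reached by continuity. -/
theorem fderiv_polarForm_smul_line {σ : ℝ → ℝ}
    (hsm : ContDiff ℝ ∞ (polarForm σ : V → V →L[ℝ] V →L[ℝ] ℝ)) (ν u : V) (t : ℝ) :
    fderiv ℝ (polarForm σ) (t • ν) ν ν u = 0 := by
  have hcont : Continuous fun t : ℝ => fderiv ℝ (polarForm σ) (t • ν) ν ν u :=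
    ((((hsm.continuous_fderiv (by simp)).comp (continuous_id.smul continuous_const)).clm_apply
      continuous_const).clm_apply continuous_const).clm_apply continuous_const
  refine congrFun (hcont.ext_on (dense_compl_singleton (0 : ℝ)) continuous_const ?_) t
  intro t ht
  have ht : t ≠ 0 := ht
  have h := fderiv_polarForm_add hsm (t • ν) (t • ν) u
  rw [polarForm_self_left] at h
  simpa [ht] using h

set_option synthInstance.maxHeartbeats 200000 in
theorem fderiv_polarForm_transverse_line {σ : ℝ → ℝ}
    (hsm : ContDiff ℝ ∞ (polarForm σ : V → V →L[ℝ] V →L[ℝ] ℝ)) (ν w : V) (t : ℝ) :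
    fderiv ℝ (polarForm σ) (t • ν) w ν ν = 0 := by
  have hcont : Continuous fun t : ℝ => fderiv ℝ (polarForm σ) (t • ν) w ν ν :=
    ((((hsm.continuous_fderiv (by simp)).comp (continuous_id.smul continuous_const)).clm_apply
      continuous_const).clm_apply continuous_const).clm_apply continuous_const
  refine congrFun (hcont.ext_on (dense_compl_singleton (0 : ℝ)) continuous_const ?_) t
  intro t ht
  have ht : t ≠ 0 := ht
  have h := fderiv_polarForm_add hsm (t • ν) w (t • ν)
  rw [polarForm_symm, polarForm_self_left, real_inner_comm] at h
  simpa [ht] using h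

end PolarDeriv

/-! ### The warped product metric in charts -/

section WarpedChart

variable {V : Type*} [NormedAddCommGroup V] [InnerProductSpace ℝ V]
  {E : Type*} [NormedAddCommGroup E] [NormedSpace ℝ E]
  {H : Type*} [TopologicalSpace H] {I : ModelWithCorners ℝ E H}
  {N : Type*} [TopologicalSpace N] [ChartedSpace H N]

theorem extChartAt_vectorSpace_prod (x₀ z : V × N) :
    extChartAt (𝓘(ℝ, V).prod I) x₀ z = (z.1, extChartAt I x₀.2 z.2) := by
  rw [extChartAt_prod]; rfl

theorem extChartAt_vectorSpace_prod_symm (x₀ : V × N) (z : V × E) :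
    (extChartAt (𝓘(ℝ, V).prod I) x₀).symm z = (z.1, (extChartAt I x₀.2).symm z.2) := by
  rw [extChartAt_prod]; rfl

theorem mem_extChartAt_vectorSpace_prod_target (x₀ : V × N) (z : V × E) :
    z ∈ (extChartAt (𝓘(ℝ, V).prod I) x₀).target ↔ z.2 ∈ (extChartAt I x₀.2).target := by
  rw [extChartAt_prod]; simp [PartialEquiv.prod, chartAt_self_eq]

variable [FiniteDimensional ℝ V] [FiniteDimensional ℝ E] [I.Boundaryless] [IsManifold I ∞ N]
  {σ : ℝ → ℝ} {hσpos : ∀ r, 0 < r → 0 < σ r}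
  {hsm : ContDiff ℝ ∞ (polarForm σ : V → V →L[ℝ] V →L[ℝ] ℝ)}
  {gN : RiemMetric I N} {ρ : V → ℝ} {hρ : ContMDiff 𝓘(ℝ, V) 𝓘(ℝ, ℝ) ∞ ρ}
  {hρpos : ∀ b, 0 < ρ b}

theorem metricInChart_warpedProduct (x₀ : V × N) {y : V × E}
    (hy : y.2 ∈ (extChartAt I x₀.2).target) (u v : V × E) :
    metricInChart (warpedProduct (polarMetric σ hσpos hsm) gN ρ hρ hρpos) x₀ y u v
      = polarForm σ y.1 u.1 v.1 + ρ y.1 ^ 2 * metricInChart gN x₀.2 y.2 u.2 v.2 := by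
  have hsymm : MDifferentiableAt 𝓘(ℝ, E) I (extChartAt I x₀.2).symm y.2 :=
    ((contMDiffOn_extChartAt_symm (n := ∞) x₀.2).contMDiffAt
      ((isOpen_extChartAt_target x₀.2).mem_nhds hy)).mdifferentiableAt (by simp)
  have hsnd : MDifferentiableAt 𝓘(ℝ, V × E) 𝓘(ℝ, E) (Prod.snd : V × E → E) y :=
    (differentiableAt_snd (𝕜 := ℝ)).mdifferentiableAt
  have hfst : MDifferentiableAt 𝓘(ℝ, V × E) 𝓘(ℝ, V) (Prod.fst : V × E → V) y :=
    (differentiableAt_fst (𝕜 := ℝ)).mdifferentiableAt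
  have hcomp : MDifferentiableAt 𝓘(ℝ, V × E) I
      ((extChartAt I x₀.2).symm ∘ (Prod.snd : V × E → E)) y := hsymm.comp y hsnd
  have hF : ∀ u : V × E, mfderiv 𝓘(ℝ, V × E) (𝓘(ℝ, V).prod I)
      (extChartAt (𝓘(ℝ, V).prod I) x₀).symm y u
      = (u.1, mfderiv 𝓘(ℝ, E) I (extChartAt I x₀.2).symm y.2 u.2) := by
    intro u
    have h1 : ((extChartAt (𝓘(ℝ, V).prod I) x₀).symm : V × E → V × N)
        = fun z => (Prod.fst z, ((extChartAt I x₀.2).symm ∘ (Prod.snd : V × E → E)) z) :=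
      funext fun z => extChartAt_vectorSpace_prod_symm x₀ z
    rw [h1, mfderiv_prodMk hfst hcomp, mfderiv_comp y hsymm hsnd]
    rw [mfderiv_eq_fderiv, mfderiv_eq_fderiv, fderiv_fst, fderiv_snd]
    rfl
  rw [metricInChart_apply, hF, hF]
  change warpedForm (polarMetric σ hσpos hsm) gN ρ _ _ _ = _
  exact warpedForm_apply _ _ _ _ _ _

set_option synthInstance.maxHeartbeats 200000 in
set_option maxSynthPendingDepth 3 in
theorem fderiv_metricInChart_warpedProduct (x₀ : V × N) {y : V × E}
    (hy : y.2 ∈ (extChartAt I x₀.2).target) (u v w : V × E) :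
    fderiv ℝ (metricInChart (warpedProduct (polarMetric σ hσpos hsm) gN ρ hρ hρpos) x₀) y u v w
      = fderiv ℝ (polarForm σ) y.1 u.1 v.1 w.1
        + 2 * ρ y.1 * fderiv ℝ ρ y.1 u.1 * metricInChart gN x₀.2 y.2 v.2 w.2
        + ρ y.1 ^ 2 * fderiv ℝ (metricInChart gN x₀.2) y.2 u.2 v.2 w.2 := by
  set g := warpedProduct (polarMetric σ hσpos hsm) gN ρ hρ hρpos
  have hy' : y ∈ (extChartAt (𝓘(ℝ, V).prod I) x₀).target :=
    (mem_extChartAt_vectorSpace_prod_target x₀ y).2 hy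
  have hG : HasFDerivAt (metricInChart g x₀) (fderiv ℝ (metricInChart g x₀) y) y :=
    ((contDiffAt_metricInChart g x₀ hy').differentiableAt (by simp)).hasFDerivAt
  have hGvw := (hG.clm_apply (hasFDerivAt_const v y)).clm_apply (hasFDerivAt_const w y)
  have hP : HasFDerivAt (polarForm σ) (fderiv ℝ (polarForm σ) y.1) y.1 :=
    (hsm.differentiable (by simp) y.1).hasFDerivAt
  have hPc : HasFDerivAt (fun z : V × E => polarForm σ z.1)
      ((fderiv ℝ (polarForm σ) y.1).comp (ContinuousLinearMap.fst ℝ V E)) y :=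
    hP.comp y (hasFDerivAt_fst (𝕜 := ℝ) (E := V) (F := E) (p := y))
  have hPvw := (hPc.clm_apply (hasFDerivAt_const v.1 y)).clm_apply
    (hasFDerivAt_const w.1 y)
  have hN : HasFDerivAt (metricInChart gN x₀.2) (fderiv ℝ (metricInChart gN x₀.2) y.2) y.2 :=
    ((contDiffAt_metricInChart gN x₀.2 hy).differentiableAt (by simp)).hasFDerivAt
  have hNc : HasFDerivAt (fun z : V × E => metricInChart gN x₀.2 z.2)
      ((fderiv ℝ (metricInChart gN x₀.2) y.2).comp (ContinuousLinearMap.snd ℝ V E)) y :=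
    hN.comp y (hasFDerivAt_snd (𝕜 := ℝ) (E := V) (F := E) (p := y))
  have hNvw := (hNc.clm_apply (hasFDerivAt_const v.2 y)).clm_apply
    (hasFDerivAt_const w.2 y)
  have hR : HasFDerivAt ρ (fderiv ℝ ρ y.1) y.1 :=
    (hρ.contDiff.differentiable (by simp) y.1).hasFDerivAt
  have hR2 := (hR.comp y hasFDerivAt_fst).pow 2
  have hsum := hPvw.add (hR2.mul hNvw)
  have hev : (fun z => metricInChart g x₀ z v w) =ᶠ[𝓝 y] fun z : V × E =>
      polarForm σ z.1 v.1 w.1 + ρ z.1 ^ 2 * metricInChart gN x₀.2 z.2 v.2 w.2 := by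
    filter_upwards [((isOpen_extChartAt_target x₀.2).preimage continuous_snd).mem_nhds hy]
      with z hz using metricInChart_warpedProduct x₀ hz v w
  have h := congrArg (fun L : V × E →L[ℝ] ℝ => L u)
    (hGvw.unique (HasFDerivAt.congr_of_eventuallyEq hsum hev))
  simp at h
  rw [h]
  ring

end WarpedChart

/-! ### The normal exponential map of the central slice -/

section RadialGeodesics

variable {V : Type*} [NormedAddCommGroup V] [InnerProductSpace ℝ V] [FiniteDimensional ℝ V]
  {E : Type*} [NormedAddCommGroup E] [NormedSpace ℝ E] [FiniteDimensional ℝ E]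
  {H : Type*} [TopologicalSpace H] {I : ModelWithCorners ℝ E H}
  {N : Type*} [TopologicalSpace N] [ChartedSpace H N] [IsManifold I ∞ N]
  {σ : ℝ → ℝ} {hσpos : ∀ r, 0 < r → 0 < σ r}
  {hsm : ContDiff ℝ ∞ (polarForm σ : V → V →L[ℝ] V →L[ℝ] ℝ)}
  {gN : RiemMetric I N} {ρ : V → ℝ} {hρ : ContMDiff 𝓘(ℝ, V) 𝓘(ℝ, ℝ) ∞ ρ}
  {hρpos : ∀ b, 0 < ρ b}

/-- The normal space of `{0} × N` at `(0, p)` is `T_0 V`. -/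
theorem isNormalVector_slice_iff (p : N) (ν : V × E) :
    IsNormalVector I (warpedProduct (polarMetric σ hσpos hsm) gN ρ hρ hρpos)
      (fun x : N => ((0 : V), x)) p ν ↔ ν.2 = 0 := by
  have hi : ∀ w : E, (warpedProduct (polarMetric σ hσpos hsm) gN ρ hρ hρpos).inner ((0 : V), p) ν
      ((0, w) : V × E) = ρ 0 ^ 2 * gN.inner p ν.2 w := by
    intro w
    refine (warpedForm_apply _ _ _ _ _ _).trans ?_
    have h : (polarMetric σ hσpos hsm).inner (0 : V) ν.1 (0 : V) = 0 := map_zero _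
    exact (congrArg (· + ρ 0 ^ 2 * gN.inner p ν.2 w) h).trans (zero_add _)
  have hm : mfderiv I (𝓘(ℝ, V).prod I) (fun x : N => ((0 : V), x)) p
      = ContinuousLinearMap.inr ℝ V E := mfderiv_prod_right
  have hval : ∀ w : E, (warpedProduct (polarMetric σ hσpos hsm) gN ρ hρ hρpos).inner ((0 : V), p) ν
      (mfderiv I (𝓘(ℝ, V).prod I) (fun x : N => ((0 : V), x)) p w)
      = ρ 0 ^ 2 * gN.inner p ν.2 w := fun w =>
    (congrArg (fun L : E →L[ℝ] V × E =>
      (warpedProduct (polarMetric σ hσpos hsm) gN ρ hρ hρpos).inner ((0 : V), p) ν (L w)) hm).trans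
      (hi w)
  constructor
  · intro h
    by_contra hne
    exact (gN.pos p ν.2 hne).ne' ((mul_eq_zero.1 ((hval ν.2).symm.trans (h ν.2))).resolve_left
      (pow_pos (hρpos 0) 2).ne')
  · intro h w
    refine (hval w).trans (mul_eq_zero_of_right _ ?_)
    rw [h]
    exact congrArg (fun L : E →L[ℝ] ℝ => L w) (map_zero (gN.inner p))

theorem mem_normalBundle_slice_iff (z : N × TangentBundle (𝓘(ℝ, V).prod I) (V × N)) :
    z ∈ normalBundle I (warpedProduct (polarMetric σ hσpos hsm) gN ρ hρ hρpos)
      (fun x : N => ((0 : V), x)) ↔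
    ∃ (p : N) (ν : V), z = (p, ⟨((0 : V), p), ((ν, 0) : V × E)⟩) := by
  constructor
  · rintro ⟨p, ν, hν, rfl⟩
    have h := (isNormalVector_slice_iff p ν).1 hν
    exact ⟨p, ν.1, Prod.ext rfl (TotalSpace.ext rfl (heq_of_eq (Prod.ext rfl h)))⟩
  · rintro ⟨p, ν, rfl⟩
    exact ⟨p, ((ν, 0) : V × E), (isNormalVector_slice_iff p _).2 rfl, rfl⟩

variable [I.Boundaryless]

set_option synthInstance.maxHeartbeats 200000 in
/-- The straight line `t ↦ (t ν, p)` has zero acceleration in the charts, and its Christoffel term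
vanishes because it only involves the derivatives of the polar form along the line. -/
theorem isGeodesicOn_radial (p : N) (ν : V) (T : Set ℝ) :
    IsGeodesicOn (warpedProduct (polarMetric σ hσpos hsm) gN ρ hρ hρpos)
      (fun t : ℝ => (t • ν, p)) T := by
  constructor
  · refine ContMDiff.contMDiffOn ?_
    exact (contDiff_id.smul contDiff_const).contMDiff.prodMk contMDiff_const
  intro x₀ t _ hx w
  have hd : deriv (fun s : ℝ => (s • ν, extChartAt I x₀.2 p)) = fun _ => ((ν, 0) : V × E) := by
    funext s
    have h1 : HasDerivAt (fun s : ℝ => s • ν) ν s := by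
      simpa using (hasDerivAt_id s).smul_const ν
    exact (h1.prodMk (hasDerivAt_const s _)).deriv
  have hp : extChartAt I x₀.2 p ∈ (extChartAt I x₀.2).target := by
    refine (extChartAt I x₀.2).map_source ?_
    rw [extChartAt_source]
    exact hx.2
  simp only [extChartAt_vectorSpace_prod, hd, deriv_const, map_zero, zero_apply, zero_add]
  rw [christoffel, fderiv_metricInChart_warpedProduct x₀ hp,
    fderiv_metricInChart_warpedProduct x₀ hp]
  simp [fderiv_polarForm_smul_line hsm, fderiv_polarForm_transverse_line hsm]

theorem isExp_radial (p : N) (ν : V) :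
    IsExp (warpedProduct (polarMetric σ hσpos hsm) gN ρ hρ hρpos)
      (⟨((0 : V), p), ((ν, 0) : V × E)⟩ : TangentBundle (𝓘(ℝ, V).prod I) (V × N)) (ν, p) := by
  have hγ := isGeodesicOn_radial (hσpos := hσpos) (hsm := hsm) (gN := gN) (hρ := hρ)
    (hρpos := hρpos) p ν (Ioo (-1) 2)
  refine ⟨fun t : ℝ => (t • ν, p), -1, 2, by norm_num, by norm_num, hγ, ?_, by simp⟩
  have h0 : (0 : ℝ) ∈ Ioo (-1 : ℝ) 2 := by norm_num
  have hd := mfderiv_one_eq_deriv ((hγ.contMDiffAt isOpen_Ioo h0).mdifferentiableAt (by simp))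
  have h1 : HasDerivAt (fun s : ℝ => s • ν) ν 0 := by
    simpa using (hasDerivAt_id (0 : ℝ)).smul_const ν
  have hd' : deriv (fun s : ℝ => extChartAt (𝓘(ℝ, V).prod I) ((0 : ℝ) • ν, p) (s • ν, p)) 0
      = ((ν, 0) : V × E) := by
    have hc : (fun s : ℝ => extChartAt (𝓘(ℝ, V).prod I) ((0 : ℝ) • ν, p) (s • ν, p))
        = fun s : ℝ => (s • ν, extChartAt I p p) :=
      funext fun s => extChartAt_vectorSpace_prod _ _
    rw [hc]
    exact (h1.prodMk (hasDerivAt_const 0 _)).deriv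
  refine TotalSpace.ext (by simp) (heq_of_eq ?_)
  exact hd.trans hd'

/-- The normal exponential map of `{0} × N` is `(p, (ν, 0)) ↦ (ν, p)`, whose smoothness and that of
its inverse are read off from `T(V × N) = TV × TN`. -/
theorem normalExpIsDiffeo_slice [T2Space N] :
    NormalExpIsDiffeo I (warpedProduct (polarMetric σ hσpos hsm) gN ρ hρ hρpos)
      (fun x : N => ((0 : V), x)) := by
  have hN1 : IsManifold I 1 N := IsManifold.of_le (n := ∞) (by simp)
  set g := warpedProduct (polarMetric σ hσpos hsm) gN ρ hρ hρpos
  have hexp : ∀ (p : N) (ν : V), normalExp N g (p, ⟨((0 : V), p), ((ν, 0) : V × E)⟩) = (ν, p) :=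
    fun p ν => (isExp_radial p ν).expMap_eq
  refine ⟨fun z hz => ?_, ?_, ?_⟩
  · obtain ⟨p, ν, rfl⟩ := (mem_normalBundle_slice_iff z).1 hz
    exact ⟨_, isExp_radial p ν⟩
  · have hfst : ContMDiff (I.prod (𝓘(ℝ, V).prod I).tangent) 𝓘(ℝ, V) ∞
        (fun z : N × TangentBundle (𝓘(ℝ, V).prod I) (V × N) =>
          (equivTangentBundleProd 𝓘(ℝ, V) V I N z.2).1.2) :=
      (contMDiff_snd_tangentBundle_modelSpace V 𝓘(ℝ, V)).comp
        (contMDiff_fst.comp (contMDiff_equivTangentBundleProd.comp contMDiff_snd))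
    refine ContMDiffOn.congr (hfst.prodMk contMDiff_fst).contMDiffOn ?_
    intro z hz
    obtain ⟨p, ν, rfl⟩ := (mem_normalBundle_slice_iff z).1 hz
    exact hexp p ν
  · refine ⟨fun y => (y.2, (equivTangentBundleProd 𝓘(ℝ, V) V I N).symm
      (⟨0, y.1⟩, zeroSection E (TangentSpace I) y.2)), ?_, ?_, ?_, ?_⟩
    · refine contMDiff_snd.prodMk (contMDiff_equivTangentBundleProd_symm.comp
        (ContMDiff.prodMk ?_ ((contMDiff_zeroSection ℝ (TangentSpace I : N → Type _)).comp
          contMDiff_snd)))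
      have h : ContMDiff 𝓘(ℝ, V) 𝓘(ℝ, V).tangent ∞
          (fun v : V => (⟨0, v⟩ : TangentBundle 𝓘(ℝ, V) V)) := by
        intro v
        refine (contMDiffAt_totalSpace).2 ⟨contMDiffAt_const, ?_⟩
        convert! contMDiffAt_id with w
        simp
      exact h.comp contMDiff_fst
    · exact fun y => (mem_normalBundle_slice_iff _).2 ⟨y.2, y.1, rfl⟩
    · exact fun y => hexp y.2 y.1
    · intro z hz
      obtain ⟨p, ν, rfl⟩ := (mem_normalBundle_slice_iff z).1 hz
      rw [hexp]
      rfl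

end RadialGeodesics

/-! ### Focal points -/

section FocalPoints

variable {E : Type*} [NormedAddCommGroup E] [NormedSpace ℝ E]
  {H : Type*} [TopologicalSpace H] {I : ModelWithCorners ℝ E H}
  {M : Type*} [TopologicalSpace M] [ChartedSpace H M] [IsManifold I ∞ M]
  {F : Type*} [NormedAddCommGroup F] [NormedSpace ℝ F]
  {G : Type*} [TopologicalSpace G] {J : ModelWithCorners ℝ F G}
  {N : Type*} [TopologicalSpace N] [ChartedSpace G N]

/-- The smooth inverse of a diffeomorphic normal exponential map recovers the velocity of a curve
in the normal bundle from that of its image. -/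
theorem NormalExpIsDiffeo.freeOfFocalPoints {g : RiemMetric I M} {f : N → M}
    (h : NormalExpIsDiffeo J g f) : FreeOfFocalPoints J g f := by
  rintro z ⟨-, -, c, hc, hcS, -, hne, hzero⟩
  obtain ⟨-, hΦ, Ψ, hΨ, -, -, hleft⟩ := h
  have hΦc : ContMDiff 𝓘(ℝ, ℝ) I ∞ (fun t => normalExp N g (c t)) := by
    rw [← contMDiffOn_univ]
    exact hΦ.comp hc.contMDiffOn fun t _ => hcS t
  have hcΨ : c = Ψ ∘ fun t => normalExp N g (c t) := funext fun t => (hleft _ (hcS t)).symm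
  refine hne ?_
  have h1 := mfderiv_comp (I' := I) (0 : ℝ) ((hΨ.mdifferentiable (by simp)) _)
    (hΦc.mdifferentiable (by simp) 0)
  rw [← hcΨ] at h1
  rw [h1]
  have hlin : ∀ (A : E →L[ℝ] F × E × E) (w : E), w = 0 → A w = 0 := by
    rintro A w rfl
    exact map_zero A
  exact hlin _ _ hzero

end FocalPoints

/-! ### The polar form at the unit sphere -/

section UnitSphere

variable {V : Type*} [NormedAddCommGroup V] [InnerProductSpace ℝ V] {σ : ℝ → ℝ}

set_option synthInstance.maxHeartbeats 200000 in
theorem hasFDerivAt_polarForm_apply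
    (hsm : ContDiff ℝ ∞ (polarForm σ : V → V →L[ℝ] V →L[ℝ] ℝ)) (y v w : V) :
    HasFDerivAt (fun z => polarForm σ z v w)
      (((fderiv ℝ (polarForm σ) y).flip v).flip w) y := by
  have hd : HasFDerivAt (polarForm σ) (fderiv ℝ (polarForm σ) y) y :=
    (hsm.differentiable (by simp) y).hasFDerivAt
  refine ((hd.clm_apply (hasFDerivAt_const v y)).clm_apply (hasFDerivAt_const w y)).congr_fderiv ?_
  ext u
  simp

theorem fderiv_polarForm_symm (hsm : ContDiff ℝ ∞ (polarForm σ : V → V →L[ℝ] V →L[ℝ] ℝ))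
    (y u v w : V) : fderiv ℝ (polarForm σ) y u v w = fderiv ℝ (polarForm σ) y u w v := by
  have h : (fun z : V => polarForm σ z v w) = fun z => polarForm σ z w v :=
    funext fun z => polarForm_symm σ z v w
  exact congrArg (fun L : V →L[ℝ] ℝ => L u)
    ((hasFDerivAt_polarForm_apply hsm y v w).unique (h ▸ hasFDerivAt_polarForm_apply hsm y w v))

theorem polarForm_orthogonal {x u : V} (hx : x ≠ 0) (hu : inner ℝ x u = 0) (v : V) :
    polarForm σ x u v = σ ‖x‖ ^ 2 * (‖x‖ ^ 2)⁻¹ * inner ℝ u v := by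
  rw [polarForm_apply σ hx, hu]
  ring

/-- On vectors tangent to the spheres the metric is `σ(r)² / r²` times the Euclidean one; as
`σ'(1) = 0`, only the factor `1 / r²` contributes to its radial derivative at `r = 1`. -/
theorem fderiv_polarForm_radial (hsm : ContDiff ℝ ∞ (polarForm σ : V → V →L[ℝ] V →L[ℝ] ℝ))
    (hσ1 : HasDerivAt σ 0 1) {x u : V} (hx : ‖x‖ = 1) (hu : inner ℝ x u = 0) (v : V) :
    fderiv ℝ (polarForm σ) x x u v = -2 * σ 1 ^ 2 * inner ℝ u v := by
  have hline : HasDerivAt (fun t : ℝ => t • x) x 1 := by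
    simpa using (hasDerivAt_id (1 : ℝ)).smul_const x
  have h1 : HasDerivAt (fun t : ℝ => polarForm σ (t • x) u v)
      (fderiv ℝ (polarForm σ) x x u v) 1 := by
    have h := hasFDerivAt_polarForm_apply hsm ((1 : ℝ) • x) u v
    have h' := h.comp_hasDerivAt (1 : ℝ) hline
    simpa [Function.comp_def] using h'
  have hev : (fun t : ℝ => polarForm σ (t • x) u v)
      =ᶠ[𝓝 1] fun t : ℝ => σ t ^ 2 * (t ^ 2)⁻¹ * inner ℝ u v := by
    filter_upwards [lt_mem_nhds (zero_lt_one (α := ℝ))] with t ht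
    have hx0 : t • x ≠ 0 := by
      refine smul_ne_zero ht.ne' ?_
      rintro rfl
      simp at hx
    have hn : ‖t • x‖ = t := by rw [norm_smul, hx, Real.norm_of_nonneg ht.le, mul_one]
    rw [polarForm_orthogonal hx0 (by rw [real_inner_smul_left, hu, mul_zero]), hn]
  have h2 : HasDerivAt (fun t : ℝ => σ t ^ 2 * (t ^ 2)⁻¹ * inner ℝ u v)
      (-2 * σ 1 ^ 2 * inner ℝ u v) 1 := by
    have h := ((hσ1.pow 2).mul (((hasDerivAt_id (1 : ℝ)).pow 2).inv (by simp))).mul_const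
      (inner ℝ u v)
    refine h.congr_deriv ?_
    simp
    left
    ring
  exact h1.unique (h2.congr_of_eventuallyEq hev)

/-- Along a map into the unit sphere, differentiating `⟪s, s⟫ = 1` twice. -/
theorem inner_fderiv_of_norm_eq_one {F : Type*} [NormedAddCommGroup F] [NormedSpace ℝ F]
    {s : F → V} {a : F} (hs : ContDiffAt ℝ ∞ s a) (h1 : ∀ z, ‖s z‖ = 1) (u v : F) :
    inner ℝ (s a) (fderiv ℝ s a v) = 0 ∧
      inner ℝ (s a) (fderiv ℝ (fderiv ℝ s) a u v)
        = -inner ℝ (fderiv ℝ s a u) (fderiv ℝ s a v) := by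
  have horth : ∀ z, DifferentiableAt ℝ s z → inner ℝ (s z) (fderiv ℝ s z v) = 0 := by
    intro z hz
    have h := hz.hasFDerivAt.inner ℝ hz.hasFDerivAt
    have hc : (fun z => inner ℝ (s z) (s z)) = fun _ : F => (1 : ℝ) :=
      funext fun z => by rw [real_inner_self_eq_norm_sq, h1]; norm_num
    have h2 := congrArg (fun L : F →L[ℝ] ℝ => L v) ((hc ▸ h).unique (hasFDerivAt_const 1 z))
    have h3 : inner ℝ (s z) (fderiv ℝ s z v) + inner ℝ (fderiv ℝ s z v) (s z) = 0 := by
      simpa [fderivInnerCLM_apply] using h2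
    rw [real_inner_comm] at h3
    linarith [real_inner_comm (s z) (fderiv ℝ s z v)]
  have hd : DifferentiableAt ℝ s a := hs.differentiableAt (by simp)
  refine ⟨horth a hd, ?_⟩
  have hev : (fun z => inner ℝ (s z) (fderiv ℝ s z v)) =ᶠ[𝓝 a] fun _ => (0 : ℝ) := by
    filter_upwards [(hs.of_le (m := 1) (by simp)).eventually (by simp)] with z hz
      using horth z (hz.differentiableAt (by simp))
  have hd2 : HasFDerivAt (fderiv ℝ s) (fderiv ℝ (fderiv ℝ s) a) a :=
    ((hs.fderiv_right (m := ∞) (by simp)).differentiableAt (by simp)).hasFDerivAt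
  have h := hd.hasFDerivAt.inner ℝ (hd2.clm_apply (hasFDerivAt_const v a))
  have h2 := congrArg (fun L : F →L[ℝ] ℝ => L u)
    (h.unique ((hasFDerivAt_const (0 : ℝ) a).congr_of_eventuallyEq hev))
  have h3 : inner ℝ (s a) (fderiv ℝ (fderiv ℝ s) a u v)
      + inner ℝ (fderiv ℝ s a u) (fderiv ℝ s a v) = 0 := by
    simpa [fderivInnerCLM_apply] using h2
  linarith

end UnitSphere

/-! ### The unit sphere times a manifold in charts -/

section SphereProduct

variable {V : Type*} [NormedAddCommGroup V] [InnerProductSpace ℝ V]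
  {n : ℕ} [Fact (Module.finrank ℝ V = n + 1)]
  {E : Type*} [NormedAddCommGroup E] [NormedSpace ℝ E]
  {H : Type*} [TopologicalSpace H] {I : ModelWithCorners ℝ E H}
  {N : Type*} [TopologicalSpace N] [ChartedSpace H N]

/-- The parametrization of the unit sphere by the chart at `x`. -/
noncomputable def sphereParam (x : Metric.sphere (0 : V) 1) (z : EuclideanSpace ℝ (Fin n)) : V :=
  ((extChartAt (𝓡 n) x).symm z : Metric.sphere (0 : V) 1)

theorem norm_sphereParam (x : Metric.sphere (0 : V) 1) (z : EuclideanSpace ℝ (Fin n)) :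
    ‖sphereParam x z‖ = 1 := norm_eq_of_mem_sphere _

theorem sphereParam_extChartAt (x : Metric.sphere (0 : V) 1) :
    sphereParam x (extChartAt (𝓡 n) x x) = x :=
  congrArg Subtype.val (extChartAt_to_inv (I := 𝓡 n) x)

theorem contDiffAt_sphereParam (x : Metric.sphere (0 : V) 1) :
    ContDiffAt ℝ ∞ (sphereParam x) (extChartAt (𝓡 n) x x) := by
  have h : ContMDiffAt 𝓘(ℝ, EuclideanSpace ℝ (Fin n)) (𝓡 n) ∞ (extChartAt (𝓡 n) x).symm
      (extChartAt (𝓡 n) x x) :=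
    (contMDiffOn_extChartAt_symm x).contMDiffAt (extChartAt_target_mem_nhds x)
  exact ((contMDiff_coe_sphere _).comp _ h).contDiffAt

theorem fderiv_sphereParam (x : Metric.sphere (0 : V) 1) :
    fderiv ℝ (sphereParam x) (extChartAt (𝓡 n) x x)
      = mfderiv (𝓡 n) 𝓘(ℝ, V) (Subtype.val : Metric.sphere (0 : V) 1 → V) x := by
  rw [((contMDiff_coe_sphere (m := 1) x).mdifferentiableAt one_ne_zero).mfderiv]
  simp only [ModelWithCorners.range_eq_univ, fderivWithin_univ]
  rfl

theorem injective_fderiv_sphereParam (x : Metric.sphere (0 : V) 1) :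
    Function.Injective (fderiv ℝ (sphereParam x) (extChartAt (𝓡 n) x x)) := by
  have h := injective_mvfderiv_subtypeVal_sphere (n := n) x
  rw [fderiv_sphereParam]
  exact h

theorem exists_fderiv_sphereParam_eq (x : Metric.sphere (0 : V) 1) {τ : V}
    (hτ : inner ℝ (x : V) τ = 0) :
    ∃ w, fderiv ℝ (sphereParam x) (extChartAt (𝓡 n) x x) w = τ := by
  have h : τ ∈ (mvfderiv (𝓡 n) (Subtype.val : Metric.sphere (0 : V) 1 → V) x).range := by
    rw [range_mvfderiv_subtypeVal]
    exact Submodule.mem_orthogonal_singleton_iff_inner_right.2 hτ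
  obtain ⟨w, hw⟩ := h
  refine ⟨w, ?_⟩
  rw [fderiv_sphereParam]
  exact hw

/-- The inclusion of `S × N` in `V × N`, where `S` is the unit sphere. -/
noncomputable def sphereProdInclusion (N : Type*) (q : Metric.sphere (0 : V) 1 × N) : V × N := (q.1, q.2)

theorem contMDiff_sphereProdInclusion :
    ContMDiff ((𝓡 n).prod I) (𝓘(ℝ, V).prod I) ∞ (sphereProdInclusion (V := V) N) :=
  (contMDiff_coe_sphere.comp contMDiff_fst).prodMk contMDiff_snd

theorem mfderiv_sphereProdInclusion (p : Metric.sphere (0 : V) 1 × N)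
    (u : EuclideanSpace ℝ (Fin n) × E) :
    mfderiv ((𝓡 n).prod I) (𝓘(ℝ, V).prod I) (sphereProdInclusion N) p u
      = (fderiv ℝ (sphereParam p.1) (extChartAt (𝓡 n) p.1 p.1) u.1, u.2) := by
  have h : mfderiv ((𝓡 n).prod I) (𝓘(ℝ, V).prod I)
      (Prod.map (Subtype.val : Metric.sphere (0 : V) 1 → V) (id : N → N)) p = _ :=
    mfderiv_prodMap ((contMDiff_coe_sphere (m := 1) p.1).mdifferentiableAt one_ne_zero)
      mdifferentiableAt_id
  rw [mfderiv_id, ← fderiv_sphereParam] at h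
  exact congrArg (fun L : EuclideanSpace ℝ (Fin n) × E →L[ℝ] V × E => L u) h

variable [I.Boundaryless]

theorem writtenInExtChartAt_sphereProdInclusion (p : Metric.sphere (0 : V) 1 × N) :
    writtenInExtChartAt ((𝓡 n).prod I) (𝓘(ℝ, V).prod I) p (sphereProdInclusion N)
      =ᶠ[𝓝 (extChartAt ((𝓡 n).prod I) p p)]
      fun z : EuclideanSpace ℝ (Fin n) × E => (sphereParam p.1 z.1, z.2) := by
  filter_upwards [extChartAt_target_mem_nhds p] with z hz
  have hz2 : z.2 ∈ (extChartAt I p.2).target := by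
    rw [extChartAt_prod] at hz
    exact hz.2
  simp only [writtenInExtChartAt, Function.comp_apply, extChartAt_vectorSpace_prod]
  rw [extChartAt_prod]
  exact Prod.ext rfl ((extChartAt I p.2).right_inv hz2)

theorem fderiv_fderiv_sphereProdInclusion (p : Metric.sphere (0 : V) 1 × N)
    (u v : EuclideanSpace ℝ (Fin n) × E) :
    fderiv ℝ (fderiv ℝ
        (writtenInExtChartAt ((𝓡 n).prod I) (𝓘(ℝ, V).prod I) p (sphereProdInclusion N)))
      (extChartAt ((𝓡 n).prod I) p p) u v
      = (fderiv ℝ (fderiv ℝ (sphereParam p.1)) (extChartAt (𝓡 n) p.1 p.1) u.1 v.1, 0) := by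
  rw [(writtenInExtChartAt_sphereProdInclusion p).fderiv.fderiv_eq]
  have hz : extChartAt ((𝓡 n).prod I) p p = (extChartAt (𝓡 n) p.1 p.1, extChartAt I p.2 p.2) := by
    rw [extChartAt_prod]; rfl
  rw [hz]
  set a := extChartAt (𝓡 n) p.1 p.1
  set b := extChartAt I p.2 p.2
  set s : EuclideanSpace ℝ (Fin n) → V := sphereParam p.1
  have hs : ContDiffAt ℝ ∞ s a := contDiffAt_sphereParam p.1
  have hs' : ContDiffAt ℝ ∞ (fun z : EuclideanSpace ℝ (Fin n) × E => s z.1) (a, b) :=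
    ContDiffAt.comp (g := s) (a, b) hs contDiffAt_fst
  have hψ : ContDiffAt ℝ ∞ (fun z : EuclideanSpace ℝ (Fin n) × E => (s z.1, z.2)) (a, b) :=
    hs'.prodMk contDiffAt_snd
  have hev : (fun z => fderiv ℝ (fun z : EuclideanSpace ℝ (Fin n) × E => (s z.1, z.2)) z v)
      =ᶠ[𝓝 (a, b)] fun z => (fderiv ℝ s z.1 v.1, v.2) := by
    have h1 : ∀ᶠ z : EuclideanSpace ℝ (Fin n) × E in 𝓝 (a, b), ContDiffAt ℝ 1 s z.1 :=
      continuousAt_fst.eventually ((hs.of_le (m := 1) (by simp)).eventually (by simp))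
    filter_upwards [h1] with z hz
    have h2 : HasFDerivAt s (fderiv ℝ s z.1) z.1 := (hz.differentiableAt (by simp)).hasFDerivAt
    have h3 := (h2.comp z (hasFDerivAt_fst (𝕜 := ℝ) (p := z))).prodMk
      (hasFDerivAt_snd (𝕜 := ℝ) (p := z))
    exact congrArg (fun L : EuclideanSpace ℝ (Fin n) × E →L[ℝ] V × E => L v) h3.fderiv
  have hl : HasFDerivAt (fderiv ℝ (fun z : EuclideanSpace ℝ (Fin n) × E => (s z.1, z.2)))
      (fderiv ℝ (fderiv ℝ (fun z : EuclideanSpace ℝ (Fin n) × E => (s z.1, z.2))) (a, b)) (a, b) :=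
    ((hψ.fderiv_right (m := ∞) (by simp)).differentiableAt (by simp)).hasFDerivAt
  have hl' := hl.clm_apply (hasFDerivAt_const v (a, b))
  have hr : HasFDerivAt (fderiv ℝ s) (fderiv ℝ (fderiv ℝ s) a) a :=
    ((hs.fderiv_right (m := ∞) (by simp)).differentiableAt (by simp)).hasFDerivAt
  have hr1 := hr.clm_apply (hasFDerivAt_const v.1 a)
  have hr' := (HasFDerivAt.comp (a, b) hr1 (hasFDerivAt_fst (𝕜 := ℝ) (p := (a, b)))).prodMk
    (hasFDerivAt_const v.2 (a, b))
  have h := congrArg (fun L : EuclideanSpace ℝ (Fin n) × E →L[ℝ] V × E => L u)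
    (hl'.unique (HasFDerivAt.congr_of_eventuallyEq hr' hev))
  simpa using h

end SphereProduct

/-! ### The unit sphere times a manifold is totally geodesic -/

section TotallyGeodesic

variable {V : Type*} [NormedAddCommGroup V] [InnerProductSpace ℝ V] [FiniteDimensional ℝ V]
  {n : ℕ} [Fact (Module.finrank ℝ V = n + 1)]
  {E : Type*} [NormedAddCommGroup E] [NormedSpace ℝ E] [FiniteDimensional ℝ E]
  {H : Type*} [TopologicalSpace H] {I : ModelWithCorners ℝ E H}
  {N : Type*} [TopologicalSpace N] [ChartedSpace H N] [IsManifold I ∞ N]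
  {σ : ℝ → ℝ} {hσpos : ∀ r, 0 < r → 0 < σ r}
  {hsm : ContDiff ℝ ∞ (polarForm σ : V → V →L[ℝ] V →L[ℝ] ℝ)}
  {gN : RiemMetric I N} {ρ : V → ℝ} {hρ : ContMDiff 𝓘(ℝ, V) 𝓘(ℝ, ℝ) ∞ ρ}
  {hρpos : ∀ b, 0 < ρ b}

/-- The normal space of the unit sphere times `N` is spanned by the radial direction. -/
theorem IsNormalVector.eq_radial {p : Metric.sphere (0 : V) 1 × N} {ν : V × E}
    (hν : IsNormalVector ((𝓡 n).prod I) (warpedProduct (polarMetric σ hσpos hsm) gN ρ hρ hρpos)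
      (sphereProdInclusion N) p ν) :
    ∃ l : ℝ, ν = (l • (p.1 : V), 0) := by
  set x : V := (p.1 : V) with hx_def
  have hx : ‖x‖ = 1 := norm_eq_of_mem_sphere p.1
  have hx0 : x ≠ 0 := by
    rintro h
    simp [h] at hx
  have hval : ∀ w : EuclideanSpace ℝ (Fin n) × E,
      polarForm σ x ν.1 (fderiv ℝ (sphereParam p.1) (extChartAt (𝓡 n) p.1 p.1) w.1)
        + ρ x ^ 2 * gN.inner p.2 ν.2 w.2 = 0 := by
    intro w
    have h := (congrArg ((warpedProduct (polarMetric σ hσpos hsm) gN ρ hρ hρpos).inner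
      (sphereProdInclusion N p) ν) (mfderiv_sphereProdInclusion p w)).symm.trans (hν w)
    exact (warpedForm_apply _ _ _ _ _ _).symm.trans h
  have h2 : ν.2 = 0 := by
    by_contra hne
    have h := hval (0, ν.2)
    rw [map_zero, map_zero, zero_add] at h
    exact (mul_pos (pow_pos (hρpos x) 2) (gN.pos p.2 ν.2 hne)).ne' h
  have h1 : ∀ τ : V, inner ℝ x τ = 0 → polarForm σ x ν.1 τ = 0 := by
    intro τ hτ
    obtain ⟨w, rfl⟩ := exists_fderiv_sphereParam_eq (n := n) p.1 hτ
    have h := hval (w, 0)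
    have h0 : gN.inner p.2 ν.2 (0 : E) = 0 := map_zero (gN.inner p.2 ν.2)
    simpa [h0] using h
  refine ⟨inner ℝ x ν.1, Prod.ext ?_ h2⟩
  -- The tangential part of `ν.1` is orthogonal to itself.
  set τ : V := ν.1 - (inner ℝ x ν.1 : ℝ) • x with hτ_def
  have hτ : inner ℝ x τ = 0 := by
    rw [hτ_def, inner_sub_right, real_inner_smul_right, real_inner_self_eq_norm_sq, hx]
    ring
  have hsum : ν.1 = (inner ℝ x ν.1 : ℝ) • x + τ := by rw [hτ_def]; abel
  have hzero : polarForm σ x τ τ = 0 := by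
    have h := h1 τ hτ
    rw [hsum, map_add, map_smul] at h
    simpa [polarForm_self_left, hτ] using h
  have hτ0 : τ = 0 := by
    by_contra hne
    exact (polarForm_pos σ hσpos x τ hne).ne' hzero
  exact sub_eq_zero.1 hτ0

/-- The radial direction is normal to the sphere, so it pairs to zero with a tangent gradient. -/
theorem fderiv_radial_eq_zero_of_gradient_tangent (x : Metric.sphere (0 : V) 1)
    {X : V}
    (hX : IsGradientAt (polarMetric σ hσpos hsm) ρ (x : V) X)
    (hXt : X ∈ Set.range (mfderiv (𝓡 n) 𝓘(ℝ, V)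
      (Subtype.val : Metric.sphere (0 : V) 1 → V) x)) :
    fderiv ℝ ρ x x = 0 := by
  have h : polarForm σ (x : V) X (x : V) = fderiv ℝ ρ x x := by
    have h := hX (x : V)
    rw [mfderiv_eq_fderiv] at h
    exact h
  rw [← h, polarForm_symm, polarForm_self_left]
  obtain ⟨w, hw⟩ := hXt
  rw [← fderiv_sphereParam] at hw
  have h0 := (inner_fderiv_of_norm_eq_one (contDiffAt_sphereParam x) (norm_sphereParam x) w w).1
  rw [sphereParam_extChartAt] at h0
  exact (congrArg (inner ℝ (x : V)) hw).symm.trans h0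

set_option synthInstance.maxHeartbeats 200000 in
/-- The Christoffel term of the second fundamental form of the unit sphere times `N`, paired with a
radial vector. It cancels against `⟪D²s(u, v), x⟫ = -⟪u, v⟫` for a parametrization `s` of the
sphere. -/
theorem christoffel_sphere_radial [I.Boundaryless] (hσ1 : HasDerivAt σ 0 1) (x₀ : V × N) {y : V × E}
    (hy : y.2 ∈ (extChartAt I x₀.2).target) (hy1 : ‖y.1‖ = 1) (hρy : fderiv ℝ ρ y.1 y.1 = 0)
    {u v : V × E} (hu : inner ℝ y.1 u.1 = 0) (hv : inner ℝ y.1 v.1 = 0) (l : ℝ) :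
    christoffel (warpedProduct (polarMetric σ hσpos hsm) gN ρ hρ hρpos) x₀ y u v (l • y.1, 0)
      = l * inner ℝ u.1 v.1 := by
  have hy0 : y.1 ≠ 0 := by
    intro h
    simp [h] at hy1
  have hmix : ∀ a b : V, inner ℝ y.1 a = 0 → fderiv ℝ (polarForm σ) y.1 a b y.1
      = inner ℝ a b - σ 1 ^ 2 * inner ℝ a b := by
    intro a b ha
    have h := fderiv_polarForm_add hsm y.1 a b
    rw [fderiv_polarForm_symm hsm, polarForm_orthogonal hy0 ha, hy1] at h
    linarith
  rw [christoffel, fderiv_metricInChart_warpedProduct x₀ hy,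
    fderiv_metricInChart_warpedProduct x₀ hy, fderiv_metricInChart_warpedProduct x₀ hy]
  simp only [map_smul, map_zero, smul_apply, zero_apply, smul_eq_mul, mul_zero, add_zero, hρy,
    zero_mul, hmix u.1 v.1 hu, hmix v.1 u.1 hv, fderiv_polarForm_radial hsm hσ1 hy1 hu]
  rw [real_inner_comm u.1 v.1]
  ring

theorem isTotallyGeodesicImmersion_sphere [I.Boundaryless] (hσ1 : HasDerivAt σ 0 1)
    (hρrad : ∀ x : Metric.sphere (0 : V) 1, fderiv ℝ ρ x x = 0) :
    IsTotallyGeodesicImmersion ((𝓡 n).prod I)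
      (warpedProduct (polarMetric σ hσpos hsm) gN ρ hρ hρpos) (sphereProdInclusion (V := V) N) := by
  refine ⟨contMDiff_sphereProdInclusion, fun p u v huv => ?_, fun p u v ν hν => ?_⟩
  · have h := (mfderiv_sphereProdInclusion p u).symm.trans
      (huv.trans (mfderiv_sphereProdInclusion p v))
    have h1 : (u : EuclideanSpace ℝ (Fin n) × E).1 = (v : EuclideanSpace ℝ (Fin n) × E).1 :=
      injective_fderiv_sphereParam p.1 (congrArg Prod.fst h)
    have h2 : (u : EuclideanSpace ℝ (Fin n) × E).2 = (v : EuclideanSpace ℝ (Fin n) × E).2 :=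
      congrArg (fun q : V × E => q.2) h
    exact Prod.ext h1 h2
  · obtain ⟨l, rfl⟩ := hν.eq_radial
    have hy : extChartAt (𝓘(ℝ, V).prod I) (sphereProdInclusion N p) (sphereProdInclusion N p)
        = ((p.1 : V), extChartAt I p.2 p.2) := extChartAt_vectorSpace_prod _ _
    have ht : extChartAt I p.2 p.2 ∈ (extChartAt I p.2).target := mem_extChartAt_target p.2
    obtain ⟨-, h2⟩ := inner_fderiv_of_norm_eq_one (contDiffAt_sphereParam (n := n) p.1)
      (norm_sphereParam p.1) u.1 v.1
    have htan : ∀ w, inner ℝ (p.1 : V)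
        (fderiv ℝ (sphereParam p.1) (extChartAt (𝓡 n) p.1 p.1) w) = 0 := by
      intro w
      have h := (inner_fderiv_of_norm_eq_one (contDiffAt_sphereParam (n := n) p.1)
        (norm_sphereParam p.1) w w).1
      rwa [sphereParam_extChartAt] at h
    rw [sphereParam_extChartAt] at h2
    have hII : secondFundamentalForm ((𝓡 n).prod I)
        (warpedProduct (polarMetric σ hσpos hsm) gN ρ hρ hρpos) (sphereProdInclusion N) p u v
        ((l • (p.1 : V), 0) : V × E)
        = metricInChart (warpedProduct (polarMetric σ hσpos hsm) gN ρ hρ hρpos)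
            (sphereProdInclusion N p) ((p.1 : V), extChartAt I p.2 p.2)
            (fderiv ℝ (fderiv ℝ (sphereParam p.1)) (extChartAt (𝓡 n) p.1 p.1) u.1 v.1, 0)
            (l • (p.1 : V), 0)
          + christoffel (warpedProduct (polarMetric σ hσpos hsm) gN ρ hρ hρpos)
            (sphereProdInclusion N p) ((p.1 : V), extChartAt I p.2 p.2)
            (fderiv ℝ (sphereParam p.1) (extChartAt (𝓡 n) p.1 p.1) u.1, u.2)
            (fderiv ℝ (sphereParam p.1) (extChartAt (𝓡 n) p.1 p.1) v.1, v.2)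
            (l • (p.1 : V), 0) := by
      rw [← hy, ← fderiv_fderiv_sphereProdInclusion (I := I) p u v,
        ← mfderiv_sphereProdInclusion (I := I) p u, ← mfderiv_sphereProdInclusion (I := I) p v]
      rfl
    rw [hII, christoffel_sphere_radial hσ1 _ ht (norm_eq_of_mem_sphere p.1) (hρrad p.1)
      (htan u.1) (htan v.1), metricInChart_warpedProduct _ ht]
    rw [polarForm_symm, map_smul, smul_apply, polarForm_self_left, h2]
    simp

end TotallyGeodesic

theorem mainTheorem11
    (n : ℕ) (hn : 1 ≤ n)
    (σ : ℝ → ℝ) (hσ : ContDiffOn ℝ ∞ σ (Ici 0)) (hσpos : ∀ r, 0 < r → 0 < σ r)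
    (hσ0 : σ 0 = 0) (hσ0' : derivWithin σ (Ici 0) 0 = 1) (hσ1' : deriv σ 1 = 0)
    (hsm : ContDiff ℝ ∞ (polarForm σ : EuclideanSpace ℝ (Fin (n + 1)) → _))
    {E : Type*} [NormedAddCommGroup E] [NormedSpace ℝ E] [FiniteDimensional ℝ E]
    {H : Type*} [TopologicalSpace H] (I : ModelWithCorners ℝ E H) [I.Boundaryless]
    {N' : Type*} [TopologicalSpace N'] [T2Space N'] [ChartedSpace H N'] [IsManifold I ∞ N']
    (gN : RiemMetric I N')
    (ρ : EuclideanSpace ℝ (Fin (n + 1)) → ℝ)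
    (hρ : ContMDiff 𝓘(ℝ, EuclideanSpace ℝ (Fin (n + 1))) 𝓘(ℝ, ℝ) ∞ ρ) (hρpos : ∀ b, 0 < ρ b)
    (hgrad : ∀ p : Metric.sphere (0 : EuclideanSpace ℝ (Fin (n + 1))) 1,
      ∃ X : TangentSpace 𝓘(ℝ, EuclideanSpace ℝ (Fin (n + 1))) (p : EuclideanSpace ℝ (Fin (n + 1))),
        IsGradientAt (polarMetric σ hσpos hsm) ρ p X ∧
        X ∈ Set.range (mfderiv (𝓡 n) 𝓘(ℝ, EuclideanSpace ℝ (Fin (n + 1)))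
          (Subtype.val : Metric.sphere (0 : EuclideanSpace ℝ (Fin (n + 1))) 1 → _) p)) :
    IsTotallyGeodesicImmersion ((𝓡 n).prod I)
        (warpedProduct (polarMetric σ hσpos hsm) gN ρ hρ hρpos)
        (fun q : Metric.sphere (0 : EuclideanSpace ℝ (Fin (n + 1))) 1 × N' =>
          ((q.1 : EuclideanSpace ℝ (Fin (n + 1))), q.2)) ∧
      NormalExpIsDiffeo I (warpedProduct (polarMetric σ hσpos hsm) gN ρ hρ hρpos)
        (fun x : N' => ((0 : EuclideanSpace ℝ (Fin (n + 1))), x)) ∧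
      FreeOfFocalPoints I (warpedProduct (polarMetric σ hσpos hsm) gN ρ hρ hρpos)
        (fun x : N' => ((0 : EuclideanSpace ℝ (Fin (n + 1))), x)) := by
  have hexp := normalExpIsDiffeo_slice (hσpos := hσpos) (hsm := hsm) (gN := gN) (hρ := hρ)
    (hρpos := hρpos)
  refine ⟨?_, hexp, hexp.freeOfFocalPoints⟩
  have : Fact (Module.finrank ℝ (EuclideanSpace ℝ (Fin (n + 1))) = n + 1) :=
    ⟨finrank_euclideanSpace_fin⟩
  have hσ1 : HasDerivAt σ 0 1 := by
    rw [← hσ1']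
    exact ((hσ.contDiffAt (Ici_mem_nhds zero_lt_one)).differentiableAt (by simp)).hasDerivAt
  refine isTotallyGeodesicImmersion_sphere hσ1 fun x => ?_
  obtain ⟨X, hX, hXt⟩ := hgrad x
  exact fderiv_radial_eq_zero_of_gradient_tangent x hX hXt
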